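/- Let $n\ge 1$ and let $\mathbb R_n$ be the real Clifford algebra with imaginary units $e_1,\dots,e_n$ ($e_i^2=-1$, $e_ie_j=-e_je_i$ for $i\ne j$), with the Euclidean norm $\|\sum_A y_Ae_A\|^2=\sum_A|y_A|^2$. A $C^1$ function $f:\mathbb R^{n+1}\to\mathbb R_n$ is entire left monogenic if $\partial_{x_0}f+\sum_{i=1}^n e_i\partial_{x_i}f=0$. For a multi-index $\mathbf m\in\mathbb N_0^n$ let $|\mathbf m|=m_1+\dots+m_n$, $\mathbf m!=m_1!\cdots m_n!$, and let $V_{\mathbf m}(x)=\frac{\mathbf m!}{|\mathbf m|!}\sum z_{j_1}\cdots z_{j_{|\mathbf m|}}$ be the Fueter polynomial, where $z_i=x_i-x_0e_i$ and the sum runs over all distinct arrangements $(j_1,\dots,j_{|\mathbf m|})$ in which each $i$ occurs $m_i$ times. If $f(x)=\sum_{\mathbf m}V_{\mathbf m}(x)a_{\mathbf m}$ (unconditionally convergent) for all $x\in\mathbb R^{n+1}$, then the $a_{\mathbf m}\in\mathbb R_n$ are called the Fueter coefficients of $f$. Let $\rho>0$ and let $\rho(r)\ge0$ be a proximate order for $\rho$,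 that is, a differentiable function on $[0,\infty)$ with $\rho(r)\to\rho$ and $\rho'(r)\,r\ln r\to0$ as $r\to+\infty$. Let $\hat\rho(r)$ be a normalization of it, that is, a proximate order for $\rho$ with $\hat\rho(r)=\rho(r)$ for all large $r$ such that $r\mapsto r^{\hat\rho(r)}$ is strictly increasing from $(0,\infty)$ onto $(0,\infty)$; let $\varphi$ be the inverse of this map and $G_{\hat\rho,q}=\varphi(q)^q/(e\rho)^{q/\rho}$. For $\sigma>0$ let $A_{\rho,\sigma}$ be the space of entire left monogenic $f$ with $\sup_x\|f(x)\|\exp(-\sigma\|x\|^{\rho(\|x\|)})<\infty$; for $\sigma\ge0$ put $A_{\rho,\sigma+0}=\bigcap_{\varepsilon>0}A_{\rho,\sigma+\varepsilon}$, and put $A_\rho=\bigcup_{\sigma>0}A_{\rho,\sigma}$. Let $\sigma\ge0$ in (1) and (2). 1. If $f(x)=\sum_{\mathbf m}V_{\mathbf m}(x)a_{\mathbf m}$ belongs to $A_{\rho,\sigma+0}$, then $$\limsup_{q\to\infty}\Big(\max_{|\mathbf m|=q}\|a_{\mathbf m}\|\,G_{\hat\rho,q}\Big)^{\rho/q}\le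 n^\rho\sigma.\qquad(*)$$ 2. Conversely, if a family $(a_{\mathbf m})$ in $\mathbb R_n$ satisfies $(*)$, then $\sum_{\mathbf m}V_{\mathbf m}(x)a_{\mathbf m}$ converges for all $x\in\mathbb R^{n+1}$ and its sum $f$ belongs to $A_{\rho,n^\rho\sigma+0}$. 3. An entire left monogenic function $f(x)=\sum_{\mathbf m}V_{\mathbf m}(x)a_{\mathbf m}$ belongs to $A_\rho$ if and only if $$\limsup_{q\to\infty}\Big(\max_{|\mathbf m|=q}\|a_{\mathbf m}\|\,G_{\hat\rho,q}\Big)^{\rho/q}<\infty.$$ -/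

import Mathlib

open scoped symmDiff NNReal ENNReal

noncomputable section

namespace Monogenic

/-! ### The real Clifford algebra with `n` imaginary units -/

/-- The real Clifford algebra `ℝ_n`: its elements are `y = ∑_A y_A e_A`, with `A` running through the
subsets of the index set, and it carries the Euclidean norm `|y|² = ∑_A |y_A|²`.
The index `i : Fin n` stands for the imaginary unit `e_{i+1}`. -/
def Cl (n : ℕ) : Type := EuclideanSpace ℝ (Finset (Fin n))

namespace Cl

variable {n : ℕ}

instance : NormedAddCommGroup (Cl n) :=
  inferInstanceAs (NormedAddCommGroup (EuclideanSpace ℝ (Finset (Fin n))))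

instance : InnerProductSpace ℝ (Cl n) :=
  inferInstanceAs (InnerProductSpace ℝ (EuclideanSpace ℝ (Finset (Fin n))))

instance : FiniteDimensional ℝ (Cl n) :=
  inferInstanceAs (FiniteDimensional ℝ (EuclideanSpace ℝ (Finset (Fin n))))

/-- The coordinate `y_A`. -/
def coord (y : Cl n) (A : Finset (Fin n)) : ℝ := WithLp.ofLp y A

/-- The Clifford number with prescribed coordinates. -/
def ofCoord (c : Finset (Fin n) → ℝ) : Cl n := WithLp.toLp 2 c

@[simp] theorem coord_ofCoord (c : Finset (Fin n) → ℝ) (A : Finset (Fin n)) :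
    coord (ofCoord c) A = c A := rfl

@[ext] theorem ext {x y : Cl n} (h : ∀ A, coord x A = coord y A) : x = y :=
  WithLp.ofLp_injective 2 (funext h)

@[simp] theorem coord_add (x y : Cl n) (A : Finset (Fin n)) :
    coord (x + y) A = coord x A + coord y A := rfl

@[simp] theorem coord_zero (A : Finset (Fin n)) : coord (0 : Cl n) A = 0 := rfl

@[simp] theorem coord_smul (c : ℝ) (x : Cl n) (A : Finset (Fin n)) :
    coord (c • x) A = c * coord x A := rfl

theorem norm_sq_eq (y : Cl n) : ‖y‖ ^ 2 = ∑ A, |coord y A| ^ 2 := by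
  exact EuclideanSpace.norm_sq_eq (𝕜 := ℝ) (n := Finset (Fin n)) y

/-- The sign in `e_A e_B = ± e_{A ∆ B}`: a factor `-1` for each pair `a ∈ A`, `b ∈ B` with `a > b`
(from `e_a e_b = - e_b e_a`) or `a = b` (from `e_a² = -1`). -/
def sgn (A B : Finset (Fin n)) : ℝ := ∏ a ∈ A, ∏ b ∈ B, if b ≤ a then -1 else 1

/-- The bilinear product with `e_A e_B = sgn A B • e_{A ∆ B}`. -/
instance : Mul (Cl n) :=
  ⟨fun x y => ofCoord fun C => ∑ A, sgn A (A ∆ C) * coord x A * coord y (A ∆ C)⟩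

/-- The basis element `e_A`. -/
def e (A : Finset (Fin n)) : Cl n := ofCoord fun B => if B = A then 1 else 0

/-- The unit is `e_∅`. -/
instance : One (Cl n) := ⟨e ∅⟩

theorem coord_mul (x y : Cl n) (C : Finset (Fin n)) :
    coord (x * y) C = ∑ A, sgn A (A ∆ C) * coord x A * coord y (A ∆ C) := rfl

theorem coord_e (A B : Finset (Fin n)) : coord (e A) B = if B = A then 1 else 0 := rfl

theorem coord_one (B : Finset (Fin n)) : coord (1 : Cl n) B = if B = ∅ then 1 else 0 := rfl

theorem prod_symmDiff (A B : Finset (Fin n)) (g : Fin n → ℝ) (hg : ∀ i, g i * g i = 1) :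
    ∏ i ∈ A ∆ B, g i = (∏ i ∈ A, g i) * ∏ i ∈ B, g i := by
  have h : ∀ S : Finset (Fin n), ∏ i ∈ S, g i = ∏ i, if i ∈ S then g i else 1 := by
    intro S; simp
  rw [h, h A, h B, ← Finset.prod_mul_distrib]
  refine Finset.prod_congr rfl fun i _ => ?_
  by_cases hA : i ∈ A <;> by_cases hB : i ∈ B <;> simp [Finset.mem_symmDiff, hA, hB, hg]

theorem sgn_symmDiff_left (A B C : Finset (Fin n)) : sgn (A ∆ B) C = sgn A C * sgn B C := by
  refine prod_symmDiff A B _ fun i => ?_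
  rw [← Finset.prod_mul_distrib]
  exact Finset.prod_eq_one fun j _ => by split_ifs <;> norm_num

theorem sgn_symmDiff_right (A B C : Finset (Fin n)) : sgn A (B ∆ C) = sgn A B * sgn A C := by
  unfold sgn
  rw [← Finset.prod_mul_distrib]
  exact Finset.prod_congr rfl fun i _ => prod_symmDiff B C _ fun j => by split_ifs <;> norm_num

@[simp] theorem sgn_empty_left (A : Finset (Fin n)) : sgn ∅ A = 1 := by simp [sgn]

@[simp] theorem sgn_empty_right (A : Finset (Fin n)) : sgn A ∅ = 1 := by simp [sgn]

theorem mul_assoc' (x y z : Cl n) : x * y * z = x * (y * z) := by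
  ext C
  simp only [coord_mul, Finset.sum_mul, Finset.mul_sum]
  rw [Finset.sum_comm]
  refine Finset.sum_congr rfl fun A _ => ?_
  refine Fintype.sum_bijective (fun D => A ∆ D)
    (Function.Involutive.bijective fun D => symmDiff_symmDiff_cancel_left A D) _ _ fun D => ?_
  have h1 : (A ∆ D) ∆ (A ∆ C) = D ∆ C := by
    rw [symmDiff_symmDiff_symmDiff_comm, symmDiff_self, bot_symmDiff]
  have h2 : sgn A (A ∆ C) = sgn A (A ∆ D) * sgn A (D ∆ C) := by
    rw [← sgn_symmDiff_right]
    congr 1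
    rw [symmDiff_assoc, symmDiff_symmDiff_cancel_left]
  have h3 : sgn (A ∆ D) (D ∆ C) = sgn A (D ∆ C) * sgn D (D ∆ C) := sgn_symmDiff_left _ _ _
  have h4 : sgn A (D ∆ C) * sgn A (D ∆ C) = 1 := by
    unfold sgn
    rw [← Finset.prod_mul_distrib]
    refine Finset.prod_eq_one fun i _ => ?_
    rw [← Finset.prod_mul_distrib]
    exact Finset.prod_eq_one fun j _ => by split_ifs <;> norm_num
  rw [h1, h2, h3]
  linear_combination (-(sgn A (A ∆ D) * coord x A * coord y (A ∆ D) * coord z (D ∆ C) *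
    sgn D (D ∆ C))) * h4

instance : Ring (Cl n) where
  __ := (inferInstance : AddCommGroup (Cl n))
  mul_assoc := mul_assoc'
  one_mul x := by
    ext C
    rw [coord_mul, Finset.sum_eq_single ∅]
    · have h : (∅ : Finset (Fin n)) ∆ C = C := bot_symmDiff C
      simp [coord_one, h]
    · intro A _ hA; simp [coord_one, hA]
    · simp
  mul_one x := by
    ext C
    rw [coord_mul, Finset.sum_eq_single C]
    · simp [coord_one]
    · intro A _ hA; simp [coord_one, hA]
    · simp
  left_distrib x y z := by
    ext C
    simp only [coord_mul, coord_add, mul_add, Finset.sum_add_distrib]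
  right_distrib x y z := by
    ext C
    simp only [coord_mul, coord_add, mul_add, add_mul, Finset.sum_add_distrib]
  zero_mul x := by ext C; simp [coord_mul]
  mul_zero x := by ext C; simp [coord_mul]

instance : Algebra ℝ (Cl n) :=
  Algebra.ofModule
    (fun r x y => by
      ext C
      simp only [coord_mul, coord_smul, Finset.mul_sum]
      exact Finset.sum_congr rfl fun A _ => by ring)
    (fun r x y => by
      ext C
      simp only [coord_mul, coord_smul, Finset.mul_sum]
      exact Finset.sum_congr rfl fun A _ => by ring)

/-- The imaginary unit `e_i`. -/
def unit (i : Fin n) : Cl n := e {i}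

theorem e_mul_e (A B : Finset (Fin n)) : e A * e B = sgn A B • e (A ∆ B) := by
  ext C
  rw [coord_mul, Finset.sum_eq_single A]
  · by_cases h : C = A ∆ B
    · subst h; simp [coord_e]
    · have : A ∆ C ≠ B := by
        rintro rfl
        exact h (symmDiff_symmDiff_cancel_left A C).symm
      simp [coord_e, h, this]
  · intro D _ hD; simp [coord_e, hD]
  · simp

theorem unit_mul_self (i : Fin n) : unit i * unit i = -1 := by
  unfold unit
  rw [e_mul_e, symmDiff_self]
  have : sgn ({i} : Finset (Fin n)) {i} = -1 := by simp [sgn]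
  rw [this, neg_one_smul]
  rfl

theorem unit_anticomm {i j : Fin n} (h : i ≠ j) : unit i * unit j + unit j * unit i = 0 := by
  unfold unit
  rw [e_mul_e, e_mul_e, symmDiff_comm ({j} : Finset (Fin n)) {i}, ← add_smul]
  have : sgn ({i} : Finset (Fin n)) {j} + sgn {j} {i} = 0 := by
    rcases lt_or_gt_of_ne h with h | h <;> simp [sgn, h.le, h.not_ge]
  rw [this, zero_smul]

/-! `ℝ_n` is Mathlib's Clifford algebra of the negative definite form `-∑ v_i²` on `ℝⁿ`. -/

/-- The quadratic form `v ↦ -∑ v_i²`. -/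
def negQ (n : ℕ) : QuadraticForm ℝ (Fin n → ℝ) :=
  QuadraticMap.weightedSumSquares ℝ (fun _ : Fin n => (-1 : ℝ))

/-- The vector `∑ v_i e_i`. -/
def vec (n : ℕ) : (Fin n → ℝ) →ₗ[ℝ] Cl n := Fintype.linearCombination ℝ (unit (n := n))

theorem vec_sq (v : Fin n → ℝ) : vec n v * vec n v = algebraMap ℝ (Cl n) (negQ n v) := by
  have h : ∀ i j : Fin n, (v i • unit i) * (v j • unit j) + (v j • unit j) * (v i • unit i)
      = algebraMap ℝ (Cl n) (if i = j then -(2 * (v i * v i)) else 0) := by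
    intro i j
    simp only [smul_mul_smul_comm]
    rw [mul_comm (v j) (v i), ← smul_add]
    by_cases hij : i = j
    · subst hij
      rw [unit_mul_self, if_pos rfl, Algebra.algebraMap_eq_smul_one]
      module
    · rw [unit_anticomm hij, if_neg hij]; simp
  have h2 : (2 : ℝ) • (vec n v * vec n v) = (2 : ℝ) • algebraMap ℝ (Cl n) (negQ n v) := by
    have : (2 : ℝ) • (vec n v * vec n v) = ∑ i, ∑ j,
        ((v i • unit i) * (v j • unit j) + (v j • unit j) * (v i • unit i)) := by
      simp only [Finset.sum_add_distrib]
      rw [Finset.sum_comm (f := fun i j => (v j • unit j) * (v i • unit i)), ← two_smul ℝ]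
      simp only [vec, Fintype.linearCombination_apply, Finset.sum_mul_sum]
    rw [this]
    simp only [h, ← map_sum]
    rw [Algebra.algebraMap_eq_smul_one, Algebra.algebraMap_eq_smul_one, smul_smul]
    congr 1
    simp [negQ, QuadraticMap.weightedSumSquares_apply, Finset.mul_sum]
  exact smul_right_injective _ (two_ne_zero' ℝ) h2

/-- The canonical homomorphism from Mathlib's Clifford algebra. -/
def ofClifford (n : ℕ) : CliffordAlgebra (negQ n) →ₐ[ℝ] Cl n :=
  CliffordAlgebra.lift (negQ n) ⟨vec n, vec_sq⟩

theorem ofClifford_ι (i : Fin n) :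
    ofClifford n (CliffordAlgebra.ι (negQ n) (Pi.single i 1)) = unit i := by
  rw [ofClifford, CliffordAlgebra.lift_ι_apply]
  simp [vec, Fintype.linearCombination_apply_single]

theorem e_mem_range (A : Finset (Fin n)) : e A ∈ (ofClifford n).range := by
  induction A using Finset.induction_on with
  | empty => exact one_mem _
  | insert i A hi ih =>
    have h : e (insert i A) = sgn {i} A • (unit i * e A) := by
      unfold unit
      rw [e_mul_e, smul_smul]
      have h1 : sgn {i} A * sgn {i} A = 1 := by
        simp only [sgn, Finset.prod_singleton, ← Finset.prod_mul_distrib]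
        exact Finset.prod_eq_one fun j _ => by split_ifs <;> norm_num
      have h2 : ({i} : Finset (Fin n)) ∆ A = insert i A := by
        rw [Finset.symmDiff_eq_union (Finset.disjoint_singleton_left.2 hi), Finset.insert_eq]
      rw [h1, h2, one_smul]
    rw [h]
    exact Subalgebra.smul_mem _ (mul_mem ((ofClifford n).mem_range.2 ⟨_, ofClifford_ι i⟩) ih) _

theorem sum_coord_smul_e (y : Cl n) : ∑ A, coord y A • e A = y := by
  ext B
  have h : ∀ S : Finset (Finset (Fin n)), coord (∑ A ∈ S, coord y A • e A) B
      = ∑ A ∈ S, coord (coord y A • e A) B := by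
    intro S
    induction S using Finset.induction_on with
    | empty => simp
    | insert A S hA ih => rw [Finset.sum_insert hA, Finset.sum_insert hA, coord_add, ih]
  simp [h, coord_e]

theorem ofClifford_bijective (n : ℕ) : Function.Bijective (ofClifford n) := by
  have hs : Function.Surjective (ofClifford n).toLinearMap := by
    intro y
    have : y ∈ (ofClifford n).range := by
      rw [← sum_coord_smul_e y]
      exact sum_mem fun A _ => Subalgebra.smul_mem _ (e_mem_range A) _
    exact this
  let b := ((Pi.basisFun ℝ (Fin n)).ExteriorAlgebra).map
    (CliffordAlgebra.equivExterior (negQ n)).symm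
  have : FiniteDimensional ℝ (CliffordAlgebra (negQ n)) := b.finiteDimensional_of_finite
  have hd : Module.finrank ℝ (CliffordAlgebra (negQ n)) = Module.finrank ℝ (Cl n) := by
    rw [Module.finrank_eq_card_basis b]
    exact (finrank_euclideanSpace (𝕜 := ℝ) (ι := Finset (Fin n))).symm
  exact ⟨(LinearMap.injective_iff_surjective_of_finrank_eq_finrank hd).2 hs, hs⟩

end Cl

/-! ### Monogenic functions -/

variable {n : ℕ}

/-- The partial derivative `∂_{x_j} f`, `j = 0, …, n`. -/
def partialDeriv (j : Fin (n + 1)) (f : EuclideanSpace ℝ (Fin (n + 1)) → Cl n)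
    (x : EuclideanSpace ℝ (Fin (n + 1))) : Cl n :=
  fderiv ℝ f x (EuclideanSpace.single j 1)

/-- Entire left monogenic functions: `f` is `C¹` and `∂_{x_0} f + ∑ e_i ∂_{x_i} f = 0`. -/
def IsMonogenic (f : EuclideanSpace ℝ (Fin (n + 1)) → Cl n) : Prop :=
  ContDiff ℝ 1 f ∧
    ∀ x, partialDeriv 0 f x + ∑ i : Fin n, Cl.unit i * partialDeriv i.succ f x = 0

/-- The Fueter variable `z_i = x_i - x_0 e_i`. -/
def fueterVar (i : Fin n) (x : EuclideanSpace ℝ (Fin (n + 1))) : Cl n :=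
  x i.succ • (1 : Cl n) - x 0 • Cl.unit i

/-- The Fueter polynomial `V_m = (m! / |m|!) ∑ z_{w_1} z_{w_2} ⋯ z_{w_q}`, `q = |m|`, where `w` runs
through the distinct arrangements of the multiset in which each index `i` occurs `m_i` times. -/
def fueterPoly (m : Fin n → ℕ) (x : EuclideanSpace ℝ (Fin (n + 1))) : Cl n :=
  (((∏ i, (m i).factorial : ℕ) : ℝ) / ((∑ i, m i).factorial : ℝ)) •
    ∑ w : Fin (∑ i, m i) → Fin n with ∀ i, (Finset.univ.filter fun k => w k = i).card = m i,
      (List.ofFn fun k => fueterVar (w k) x).prod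

/-- `f(x) = ∑_m V_m(x) a_m` on all of `ℝ^{n+1}`: the `a_m` are the Fueter coefficients of `f`. -/
def HasFueterExpansion (f : EuclideanSpace ℝ (Fin (n + 1)) → Cl n)
    (a : (Fin n → ℕ) → Cl n) : Prop :=
  ∀ x, HasSum (fun m => fueterPoly m x * a m) (f x)

/-! ### Proximate orders -/

/-- `p` is a proximate order for the order `ρ`. -/
structure IsProximateOrder (p : ℝ → ℝ) (ρ : ℝ) : Prop where
  differentiableOn : DifferentiableOn ℝ p (Set.Ici 0)
  nonneg : ∀ r, 0 ≤ r → 0 ≤ p r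
  tendsto : Filter.Tendsto p Filter.atTop (nhds ρ)
  tendsto_deriv : Filter.Tendsto (fun r => deriv p r * r * Real.log r) Filter.atTop (nhds 0)

/-- `p'` is a normalization of the proximate order `p` for `ρ`: a proximate order that agrees with
`p` for large `r` and for which `r ↦ r ^ p'(r)` is strictly increasing from `(0, ∞)` onto `(0, ∞)`. -/
structure IsNormalization (p p' : ℝ → ℝ) (ρ : ℝ) : Prop where
  isProximateOrder : IsProximateOrder p' ρ
  eventually_eq : ∃ r₁ : ℝ, 0 < r₁ ∧ ∀ r, r₁ ≤ r → p' r = p r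
  strictMonoOn : StrictMonoOn (fun r : ℝ => r ^ p' r) (Set.Ioi 0)
  image_eq : (fun r : ℝ => r ^ p' r) '' Set.Ioi 0 = Set.Ioi 0

/-- `φ : (0, ∞) → (0, ∞)`, the inverse function of `t = r ^ p'(r)`. -/
def phi (p' : ℝ → ℝ) : ℝ → ℝ := Function.invFunOn (fun r : ℝ => r ^ p' r) (Set.Ioi 0)

/-- `G_q = φ(q)^q / (eρ)^{q/ρ}`. -/
def G (p' : ℝ → ℝ) (ρ : ℝ) (q : ℕ) : ℝ :=
  phi p' q ^ q / (Real.exp 1 * ρ) ^ ((q : ℝ) / ρ)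

/-! ### Spaces of monogenic functions of a given proximate order -/

/-- `A_{p,σ}`: entire left monogenic `f` with `sup_x ‖f(x)‖ exp(-σ ‖x‖ ^ p(‖x‖)) < ∞`. -/
def ASpace (n : ℕ) (p : ℝ → ℝ) (σ : ℝ) : Set (EuclideanSpace ℝ (Fin (n + 1)) → Cl n) :=
  {f | IsMonogenic f ∧
    BddAbove (Set.range fun x : EuclideanSpace ℝ (Fin (n + 1)) =>
      ‖f x‖ * Real.exp (-σ * ‖x‖ ^ p ‖x‖))}

/-- `A_{p,σ+0} = ⋂_{ε > 0} A_{p,σ+ε}`. -/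
def ASpaceInter (n : ℕ) (p : ℝ → ℝ) (σ : ℝ) : Set (EuclideanSpace ℝ (Fin (n + 1)) → Cl n) :=
  ⋂ (ε : ℝ) (_ : 0 < ε), ASpace n p (σ + ε)

/-- `A_p = ⋃_{σ > 0} A_{p,σ}`. -/
def ASpaceUnion (n : ℕ) (p : ℝ → ℝ) : Set (EuclideanSpace ℝ (Fin (n + 1)) → Cl n) :=
  ⋃ (σ : ℝ) (_ : 0 < σ), ASpace n p σ

/-- `max_{|m| = q} ‖a_m‖`. -/
def maxNorm (a : (Fin n → ℕ) → Cl n) (q : ℕ) : ℝ≥0 :=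
  (Finset.piAntidiag Finset.univ q).sup fun m => ‖a m‖₊

/-- `limsup_{q → ∞} (max_{|m| = q} ‖a_m‖ G_q)^{ρ/q}`, as an element of `[0, ∞]`. -/
def coeffLimsup (p' : ℝ → ℝ) (ρ : ℝ) (a : (Fin n → ℕ) → Cl n) : ℝ≥0∞ :=
  Filter.limsup
    (fun q : ℕ => ENNReal.ofReal (((maxNorm a q : ℝ) * G p' ρ q) ^ (ρ / (q : ℝ)))) Filter.atTop

end Monogenic

end

noncomputable section

namespace Monogenic

section

/-! ### Norms of products in the Clifford algebra -/

namespace Cl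

variable {n : ℕ}

/-! The growth of `f` and the size of its coefficients are linked by a Cauchy estimate in one
direction and by absolute summation in the other; the proximate order enters only through the
comparison of `φ(t)/φ(q)` with `(t/q)^{1/ρ}` in `abs_log_phi_sub_le`.

Cauchy estimate (`HasFueterExpansion.norm_mul_pow_le`): `‖a_m‖ r^q ≤ (n+q)^n n^q max_{‖x‖=r} ‖f‖`,
where `q = |m|`. Every `V_m b` lies in the span of the plane waves `(∑ t_i z_i)^q b`, which are
homogeneous, monogenic and harmonic. For harmonic homogeneous functions, Euler's identity and
integration by parts against a Gaussian give `q⟨F,G⟩ = ∑ ⟨∂_j F, ∂_j G⟩`. By symmetry this makes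
different degrees orthogonal, so in polar coordinates the degree `q` part `P_q` of `f` is bounded in
L² of the unit sphere by `r^{-q} max ‖f‖` times the square root of the total mass
(`integral_norm_sq_homPart_le`). The same identity, with the `x_0` derivative dropped and iterated
`q` times, bounds the Gaussian norm of `P_q` below by `∑ m! ‖a_m‖²`, because on `x_0 = 0` the
polynomial `V_m` is the monomial `x^m` (`sum_factorial_mul_norm_sq_le_gaussInner`). The radial
integral costs about `2^q q!` and `q!/m! ≤ n^q`; for `n ≥ 2` these combine to `n^{2q}`, while `n =
1` is treated exactly. Taking `r = φ(q/(ρσ))` yields `n^ρ σ`.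

Conversely `‖V_m(x) b‖ ≤ ‖x‖^q ‖b‖`, since `V_m` is an average of products of Fueter variables. For
`A < B`, `IsNormalization.exists_log_le` supplies `A^{q/ρ} r^q ≤ G_q exp(B r^{p'(r)} - δ q)` for
large `q` and `r`. The surplus `e^{-δ q}` makes the sum over all multi-indices converge, uniformly
enough to give growth of type `B`. Monogenicity of the sum follows by differentiating term by term.
-/

theorem sgn_mul_self (A B : Finset (Fin n)) : sgn A B * sgn A B = 1 := by
  unfold sgn
  rw [← Finset.prod_mul_distrib]
  refine Finset.prod_eq_one fun i _ => ?_
  rw [← Finset.prod_mul_distrib]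
  exact Finset.prod_eq_one fun j _ => by split_ifs <;> norm_num

theorem coord_unit_mul (i : Fin n) (y : Cl n) (C : Finset (Fin n)) :
    coord (unit i * y) C = sgn {i} ({i} ∆ C) * coord y ({i} ∆ C) := by
  rw [coord_mul, Finset.sum_eq_single {i}]
  · simp [unit, coord_e]
  · intro A _ hA; simp [unit, coord_e, hA]
  · simp

/-- Multiplying by `e_i` permutes the coordinates along `C ↦ {i} ∆ C`, up to signs. -/
theorem norm_unit_mul (i : Fin n) (y : Cl n) : ‖unit i * y‖ = ‖y‖ := by
  have h : ‖unit i * y‖ ^ 2 = ‖y‖ ^ 2 := by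
    rw [norm_sq_eq, norm_sq_eq]
    refine Fintype.sum_bijective (fun D => {i} ∆ D)
      (Function.Involutive.bijective fun D => symmDiff_symmDiff_cancel_left {i} D) _ _ fun C => ?_
    rw [coord_unit_mul, sq_abs, sq_abs, mul_pow, sq (sgn _ _), sgn_mul_self, one_mul]
  exact (sq_eq_sq₀ (norm_nonneg _) (norm_nonneg _)).1 h

/-- Left multiplication by an imaginary unit. -/
def unitMulIsometry (i : Fin n) : Cl n →ₗᵢ[ℝ] Cl n :=
  ⟨LinearMap.mulLeft ℝ (unit i), norm_unit_mul i⟩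

/-- An isometry with square `-1` is skew: applying it to both arguments turns the inner product into
its own negative. -/
theorem inner_unit_mul_self (i : Fin n) (y : Cl n) : inner ℝ y (unit i * y) = 0 := by
  have h := (unitMulIsometry i).inner_map_map y (unit i * y)
  have h1 : unitMulIsometry i y = unit i * y := rfl
  have h2 : unitMulIsometry i (unit i * y) = -y := by
    change unit i * (unit i * y) = -y
    rw [← mul_assoc, unit_mul_self, neg_one_mul]
  rw [h1, h2, inner_neg_right, real_inner_comm] at h
  linarith

/-- Pythagoras for the orthogonal vectors `y` and `e_i y`. The Euclidean norm of the algebra is not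
submultiplicative in general, so products of Fueter variables are estimated through this exact
formula, one left factor at a time. -/
theorem norm_sq_smul_one_sub_smul_unit_mul (a b : ℝ) (i : Fin n) (y : Cl n) :
    ‖(a • (1 : Cl n) - b • unit i) * y‖ ^ 2 = (a ^ 2 + b ^ 2) * ‖y‖ ^ 2 := by
  rw [sub_mul, smul_mul_assoc, smul_mul_assoc, one_mul, norm_sub_sq_real, norm_smul, norm_smul,
    norm_unit_mul, inner_smul_left, inner_smul_right, inner_unit_mul_self, mul_pow, mul_pow,
    Real.norm_eq_abs, Real.norm_eq_abs, sq_abs, sq_abs]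
  simp
  ring

end Cl

/-! ### Bounds for products of Fueter variables -/

variable {n : ℕ}

theorem norm_fueterVar_mul_sq (i : Fin n) (x : EuclideanSpace ℝ (Fin (n + 1))) (y : Cl n) :
    ‖fueterVar i x * y‖ ^ 2 = (x i.succ ^ 2 + x 0 ^ 2) * ‖y‖ ^ 2 :=
  Cl.norm_sq_smul_one_sub_smul_unit_mul _ _ _ _

theorem norm_fueterVar_mul_le (i : Fin n) (x : EuclideanSpace ℝ (Fin (n + 1))) (y : Cl n) :
    ‖fueterVar i x * y‖ ≤ ‖x‖ * ‖y‖ := by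
  refine le_of_sq_le_sq ?_ (by positivity)
  rw [norm_fueterVar_mul_sq, mul_pow]
  gcongr
  rw [EuclideanSpace.norm_sq_eq, Fin.sum_univ_succ]
  have := Finset.single_le_sum (f := fun j : Fin n => ‖x j.succ‖ ^ 2) (fun j _ => by positivity)
    (Finset.mem_univ i)
  simp only [Real.norm_eq_abs, sq_abs] at this ⊢
  linarith

theorem norm_prod_fueterVar_mul_le {q : ℕ} (w : Fin q → Fin n)
    (x : EuclideanSpace ℝ (Fin (n + 1))) (y : Cl n) :
    ‖(List.ofFn fun k => fueterVar (w k) x).prod * y‖ ≤ ‖x‖ ^ q * ‖y‖ := by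
  induction q with
  | zero => simp
  | succ q ih =>
    rw [List.ofFn_succ, List.prod_cons, mul_assoc, pow_succ']
    refine (norm_fueterVar_mul_le _ _ _).trans ?_
    rw [mul_assoc]
    gcongr
    exact ih fun k => w k.succ

/-! ### Arrangements -/

/-- The multi-index counting how often each index occurs in a word. -/
def wordType {q : ℕ} (w : Fin q → Fin n) (i : Fin n) : ℕ :=
  (Finset.univ.filter fun k => w k = i).card

theorem sum_wordType {q : ℕ} (w : Fin q → Fin n) : ∑ i, wordType w i = q := by
  have := Finset.card_eq_sum_card_fiberwise (s := Finset.univ) (t := Finset.univ) (f := w)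
    (by simp)
  simpa [wordType] using this.symm

theorem wordType_mem {q : ℕ} (w : Fin q → Fin n) :
    wordType w ∈ Finset.piAntidiag Finset.univ q := by
  simp [Finset.mem_piAntidiag, sum_wordType]

theorem prod_comp_word {q : ℕ} {R : Type*} [CommMonoid R] (w : Fin q → Fin n) (t : Fin n → R) :
    ∏ k, t (w k) = ∏ i, t i ^ wordType w i := by
  rw [← Finset.prod_fiberwise' Finset.univ w t]
  simp [wordType]

/-- The words in which each index `i` occurs `m i` times. -/
def words (q : ℕ) (m : Fin n → ℕ) : Finset (Fin q → Fin n) :=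
  Finset.univ.filter fun w => wordType w = m

theorem mem_words {q : ℕ} {m : Fin n → ℕ} {w : Fin q → Fin n} :
    w ∈ words q m ↔ wordType w = m := by
  simp [words]

theorem sum_words {q : ℕ} {M : Type*} [AddCommMonoid M] (g : (Fin q → Fin n) → M) :
    ∑ m ∈ Finset.piAntidiag Finset.univ q, ∑ w ∈ words q m, g w = ∑ w, g w :=
  Finset.sum_fiberwise_of_maps_to (fun w _ => wordType_mem w) g

/-- A real polynomial that vanishes as a function vanishes as a polynomial. This allows coefficients
to be compared after expanding in auxiliary real parameters `t`. -/
theorem eq_zero_of_sum_mul_prod_pow_eq_zero (s : Finset (Fin n → ℕ)) (c : (Fin n → ℕ) → ℝ)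
    (h : ∀ t : Fin n → ℝ, ∑ m ∈ s, c m * ∏ i, t i ^ m i = 0) {m : Fin n → ℕ} (hm : m ∈ s) :
    c m = 0 := by
  set P : MvPolynomial (Fin n) ℝ :=
    ∑ m ∈ s, MvPolynomial.monomial (Finsupp.equivFunOnFinite.symm m) (c m) with hP
  have hP0 : P = 0 := by
    refine MvPolynomial.funext fun t => ?_
    rw [hP, map_sum, map_zero, ← h t]
    refine Finset.sum_congr rfl fun m _ => ?_
    rw [MvPolynomial.eval_monomial, Finsupp.prod_fintype _ _ (by simp)]
    simp
  have h1 := congrArg (MvPolynomial.coeff (Finsupp.equivFunOnFinite.symm m)) hP0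
  rw [hP, MvPolynomial.coeff_sum, Finset.sum_eq_single m] at h1
  · simpa using h1
  · intro m' _ hne
    rw [MvPolynomial.coeff_monomial, if_neg]
    simpa using hne
  · exact fun h => (h hm).elim

/-- Expand `(∑ t_i)^q` by the multinomial theorem and word by word, then compare coefficients of
`t^m`. -/
theorem card_words {q : ℕ} {m : Fin n → ℕ} (hm : m ∈ Finset.piAntidiag Finset.univ q) :
    (words q m).card = Nat.multinomial Finset.univ m := by
  have h : ∀ t : Fin n → ℝ, ∑ m ∈ Finset.piAntidiag Finset.univ q,
      (((words q m).card : ℝ) - Nat.multinomial Finset.univ m) * ∏ i, t i ^ m i = 0 := by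
    intro t
    simp only [sub_mul, Finset.sum_sub_distrib]
    rw [← Finset.sum_pow_eq_sum_piAntidiag, Fintype.sum_pow, ← sum_words, sub_eq_zero]
    refine Finset.sum_congr rfl fun m _ => ?_
    rw [← nsmul_eq_mul, ← Finset.sum_const]
    refine Finset.sum_congr rfl fun w hw => ?_
    rw [prod_comp_word, mem_words.1 hw]
  exact_mod_cast sub_eq_zero.1 (eq_zero_of_sum_mul_prod_pow_eq_zero _ _ h hm)

/-- The normalization of `V_m` is the reciprocal of the number of arrangements, so `V_m` is the mean
of the products; bounds for a single product pass to `V_m` without loss. -/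
theorem card_words_eq {q : ℕ} {m : Fin n → ℕ} (hm : ∑ i, m i = q) :
    (((∏ i, (m i).factorial : ℕ) : ℝ) / (q.factorial : ℝ)) * (words q m).card = 1 := by
  rw [card_words (by simpa [Finset.mem_piAntidiag] using hm), div_mul_eq_mul_div,
    div_eq_one_iff_eq (by positivity), ← hm]
  exact_mod_cast Nat.multinomial_spec Finset.univ m

theorem factorial_le_pow_mul_prod_factorial {q : ℕ} {m : Fin n → ℕ} (hm : ∑ i, m i = q) :
    (q.factorial : ℝ) ≤ (n : ℝ) ^ q * ((∏ i, (m i).factorial : ℕ) : ℝ) := by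
  have h := card_words_eq hm
  have h2 : ((words q m).card : ℝ) ≤ (n : ℝ) ^ q := by
    have : (words q m).card ≤ n ^ q := by
      simpa using Finset.card_le_univ (words q m)
    exact_mod_cast this
  rw [div_mul_eq_mul_div, div_eq_one_iff_eq (by positivity)] at h
  rw [← h, mul_comm]
  gcongr

theorem fueterPoly_eq {q : ℕ} {m : Fin n → ℕ} (hm : ∑ i, m i = q)
    (x : EuclideanSpace ℝ (Fin (n + 1))) :
    fueterPoly m x = (((∏ i, (m i).factorial : ℕ) : ℝ) / (q.factorial : ℝ)) •
      ∑ w ∈ words q m, (List.ofFn fun k => fueterVar (w k) x).prod := by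
  subst hm
  unfold fueterPoly words
  congr 2
  ext w
  simp [funext_iff, wordType]

theorem norm_fueterPoly_mul_le {q : ℕ} {m : Fin n → ℕ} (hm : ∑ i, m i = q)
    (x : EuclideanSpace ℝ (Fin (n + 1))) (a : Cl n) :
    ‖fueterPoly m x * a‖ ≤ ‖x‖ ^ q * ‖a‖ := by
  rw [fueterPoly_eq hm, smul_mul_assoc, Finset.sum_mul, norm_smul, Real.norm_of_nonneg (by positivity)]
  calc _ ≤ (((∏ i, (m i).factorial : ℕ) : ℝ) / (q.factorial : ℝ)) *
        ∑ w ∈ words q m, ‖x‖ ^ q * ‖a‖ := by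
        gcongr
        exact (norm_sum_le _ _).trans
          (Finset.sum_le_sum fun w _ => norm_prod_fueterVar_mul_le w x a)
    _ = _ := by
        rw [Finset.sum_const, nsmul_eq_mul, ← mul_assoc, card_words_eq hm, one_mul]

/-- On this hyperplane the Fueter variables are real scalars, so all arrangements give the same
monomial. The `a_m` can therefore be read off from the restriction of the expansion to `x_0 = 0`. -/
theorem fueterPoly_of_zero {m : Fin n → ℕ} {x : EuclideanSpace ℝ (Fin (n + 1))} (hx : x 0 = 0) :
    fueterPoly m x = (∏ i, x i.succ ^ m i) • (1 : Cl n) := by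
  rw [fueterPoly_eq rfl]
  have h : ∀ w ∈ words (∑ i, m i) m, (List.ofFn fun k => fueterVar (w k) x).prod =
      (∏ i, x i.succ ^ m i) • (1 : Cl n) := by
    intro w hw
    have h1 : ∀ (q : ℕ) (w : Fin q → Fin n), (List.ofFn fun k => fueterVar (w k) x).prod =
        (∏ k, x (w k).succ) • (1 : Cl n) := by
      intro q w
      induction q with
      | zero => simp
      | succ q ih =>
        rw [List.ofFn_succ, List.prod_cons, ih fun k => w k.succ, Fin.prod_univ_succ]
        simp [fueterVar, hx, smul_smul, mul_comm]
    rw [h1, prod_comp_word w fun i => x i.succ, mem_words.1 hw]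
  rw [Finset.sum_congr rfl h, Finset.sum_const, ← Nat.cast_smul_eq_nsmul ℝ, smul_smul,
    card_words_eq rfl, one_smul]

end

section

/-- The multiplication of the Clifford algebra as a continuous bilinear map. -/
def Cl.mulL (n : ℕ) : Cl n →L[ℝ] Cl n →L[ℝ] Cl n :=
  LinearMap.toContinuousBilinearMap (LinearMap.mul ℝ (Cl n))

@[simp] theorem Cl.mulL_apply {n : ℕ} (x y : Cl n) : Cl.mulL n x y = x * y := rfl

variable {n : ℕ}

/-! ### Partial derivatives -/

theorem fderiv_apply_eq_sum_partialDeriv (f : EuclideanSpace ℝ (Fin (n + 1)) → Cl n)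
    (x v : EuclideanSpace ℝ (Fin (n + 1))) :
    fderiv ℝ f x v = ∑ j, v j • partialDeriv j f x := by
  have hv : v = ∑ j, v j • EuclideanSpace.single j (1 : ℝ) := by
    simpa using ((EuclideanSpace.basisFun (Fin (n + 1)) ℝ).sum_repr v).symm
  conv_lhs => rw [hv]
  simp [partialDeriv]

theorem partialDeriv_add {f g : EuclideanSpace ℝ (Fin (n + 1)) → Cl n}
    (hf : Differentiable ℝ f) (hg : Differentiable ℝ g) (j : Fin (n + 1)) :
    partialDeriv j (f + g) = partialDeriv j f + partialDeriv j g := by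
  funext x
  simp [partialDeriv, fderiv_add (hf x) (hg x)]

theorem partialDeriv_const_smul {f : EuclideanSpace ℝ (Fin (n + 1)) → Cl n}
    (hf : Differentiable ℝ f) (c : ℝ) (j : Fin (n + 1)) :
    partialDeriv j (c • f) = c • partialDeriv j f := by
  funext x
  simp [partialDeriv, fderiv_const_smul (hf x) c]

theorem partialDeriv_zero (j : Fin (n + 1)) :
    partialDeriv j (0 : EuclideanSpace ℝ (Fin (n + 1)) → Cl n) = 0 := by
  funext x
  simp [partialDeriv]

/-! ### Powers of linear combinations of the Fueter variables -/

/-- The coefficients of the linear function `∑ t_i z_i`. -/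
def waveDir (t : Fin n → ℝ) : Fin (n + 1) → Cl n :=
  Fin.cons (-Cl.vec n t) fun i => t i • (1 : Cl n)

/-- The linear function `∑ t_i z_i`. -/
def waveVar (t : Fin n → ℝ) : EuclideanSpace ℝ (Fin (n + 1)) →ₗ[ℝ] Cl n where
  toFun x := ∑ j, x j • waveDir t j
  map_add' x y := by simp [add_smul, Finset.sum_add_distrib]
  map_smul' c x := by simp [Finset.smul_sum, smul_smul]

theorem waveVar_apply (t : Fin n → ℝ) (x : EuclideanSpace ℝ (Fin (n + 1))) :
    waveVar t x = ∑ j, x j • waveDir t j := rfl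

theorem waveVar_single (t : Fin n → ℝ) (j : Fin (n + 1)) :
    waveVar t (EuclideanSpace.single j 1) = waveDir t j := by
  rw [waveVar_apply, Finset.sum_eq_single j] <;> simp +contextual

theorem waveVar_eq_sum_fueterVar (t : Fin n → ℝ) (x : EuclideanSpace ℝ (Fin (n + 1))) :
    waveVar t x = ∑ i, t i • fueterVar i x := by
  rw [waveVar_apply, Fin.sum_univ_succ]
  simp only [waveDir, Fin.cons_zero, Fin.cons_succ, fueterVar, smul_sub, Finset.sum_sub_distrib,
    smul_smul, Cl.vec, Fintype.linearCombination_apply, smul_neg, Finset.smul_sum]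
  simp only [mul_comm]
  abel

/-- All coefficients but the zeroth are real multiples of `1`. Powers of `∑ t_i z_i` can thus be
differentiated as in the commutative case. -/
theorem commute_waveDir (t : Fin n → ℝ) (j k : Fin (n + 1)) :
    Commute (waveDir t j) (waveDir t k) := by
  refine Fin.cases ?_ (fun j => ?_) j
  · refine Fin.cases (Commute.refl _) (fun k => ?_) k
    exact (Commute.one_right _).smul_right _
  · exact (Commute.one_left _).smul_left _

theorem commute_waveDir_waveVar (t : Fin n → ℝ) (j : Fin (n + 1))
    (x : EuclideanSpace ℝ (Fin (n + 1))) : Commute (waveDir t j) (waveVar t x) := by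
  rw [waveVar_apply]
  exact Commute.sum_right _ _ _ fun k _ => (commute_waveDir t j k).smul_right _

theorem commute_waveVar (t : Fin n → ℝ) (x y : EuclideanSpace ℝ (Fin (n + 1))) :
    Commute (waveVar t x) (waveVar t y) := by
  rw [waveVar_apply t x]
  exact Commute.sum_left _ _ _ fun k _ => (commute_waveDir_waveVar t k y).smul_left _

/-- The square of `∑ t_i e_i` is `-∑ t_i²` and cancels the remaining squares; this is what makes
waves harmonic. -/
theorem sum_waveDir_mul_self (t : Fin n → ℝ) : ∑ j, waveDir t j * waveDir t j = 0 := by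
  rw [Fin.sum_univ_succ]
  simp only [waveDir, Fin.cons_zero, Fin.cons_succ, neg_mul_neg, Cl.vec_sq, smul_mul_smul_comm,
    mul_one, ← Finset.sum_smul, Algebra.algebraMap_eq_smul_one, ← add_smul]
  simp [Cl.negQ, QuadraticMap.weightedSumSquares_apply]

theorem waveDir_zero_add_sum (t : Fin n → ℝ) :
    waveDir t 0 + ∑ i : Fin n, Cl.unit i * waveDir t i.succ = 0 := by
  simp [waveDir, Cl.vec, Fintype.linearCombination_apply]

/-- The function `(∑ t_i z_i)^q b`. -/
def wave (t : Fin n → ℝ) (q : ℕ) (b : Cl n) (x : EuclideanSpace ℝ (Fin (n + 1))) : Cl n :=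
  waveVar t x ^ q * b

theorem wave_succ (t : Fin n → ℝ) (q : ℕ) (b : Cl n) (x : EuclideanSpace ℝ (Fin (n + 1))) :
    wave t (q + 1) b x = waveVar t x * wave t q b x := by
  rw [wave, wave, pow_succ', mul_assoc]

theorem waveVar_mul_smul_wave (t : Fin n → ℝ) (q : ℕ) (b : Cl n)
    (x : EuclideanSpace ℝ (Fin (n + 1))) :
    (q : ℝ) • (waveVar t x * wave t (q - 1) b x) = (q : ℝ) • wave t q b x := by
  cases q with
  | zero => simp
  | succ q => rw [wave_succ]; rfl

/-- The derivative of `(∑ t_i z_i)^q b`. -/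
def waveDeriv (t : Fin n → ℝ) (q : ℕ) (b : Cl n) (x : EuclideanSpace ℝ (Fin (n + 1))) :
    EuclideanSpace ℝ (Fin (n + 1)) →L[ℝ] Cl n :=
  (q : ℝ) • ((Cl.mulL n).flip (wave t (q - 1) b x)).comp (waveVar t).toContinuousLinearMap

theorem waveDeriv_apply (t : Fin n → ℝ) (q : ℕ) (b : Cl n)
    (x v : EuclideanSpace ℝ (Fin (n + 1))) :
    waveDeriv t q b x v = (q : ℝ) • (waveVar t v * wave t (q - 1) b x) := rfl

theorem hasFDerivAt_wave (t : Fin n → ℝ) (q : ℕ) (b : Cl n)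
    (x : EuclideanSpace ℝ (Fin (n + 1))) :
    HasFDerivAt (wave t q b) (waveDeriv t q b x) x := by
  induction q with
  | zero =>
    have h1 : wave t 0 b = fun _ => b := by funext x; simp [wave]
    have h2 : waveDeriv t 0 b x = 0 := by ext v; simp [waveDeriv_apply]
    rw [h1, h2]
    exact hasFDerivAt_const _ _
  | succ q ih =>
    have h1 : wave t (q + 1) b = fun x => Cl.mulL n ((waveVar t).toContinuousLinearMap x)
        (wave t q b x) := by
      funext x; exact wave_succ t q b x
    rw [h1]
    refine ((Cl.mulL n).hasFDerivAt_of_bilinear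
      ((waveVar t).toContinuousLinearMap.hasFDerivAt (x := x)) ih).congr_fderiv ?_
    refine ContinuousLinearMap.ext fun v => ?_
    change waveVar t x * waveDeriv t q b x v + waveVar t v * wave t q b x =
      waveDeriv t (q + 1) b x v
    rw [waveDeriv_apply, waveDeriv_apply, mul_smul_comm, ← mul_assoc,
      (commute_waveVar t x v).eq, mul_assoc, ← mul_smul_comm, waveVar_mul_smul_wave,
      Nat.add_sub_cancel, mul_smul_comm]
    push_cast
    module

theorem contDiff_wave (t : Fin n → ℝ) (q : ℕ) (b : Cl n) {k : WithTop ℕ∞} :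
    ContDiff ℝ k (wave t q b) := by
  induction q with
  | zero =>
    have h1 : wave t 0 b = fun _ => b := by funext x; simp [wave]
    rw [h1]
    exact contDiff_const
  | succ q ih =>
    have h1 : wave t (q + 1) b = fun x => Cl.mulL n ((waveVar t).toContinuousLinearMap x)
        (wave t q b x) := by
      funext x; exact wave_succ t q b x
    rw [h1]
    exact ((Cl.mulL n).contDiff.comp ((waveVar t).toContinuousLinearMap.contDiff)).clm_apply ih

/-- The factor from the chain rule commutes past the power into the constant, so the derivative is
again a wave. For `q = 0` the scalar `q` makes the truncated exponent `q - 1` harmless. -/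
theorem partialDeriv_wave (t : Fin n → ℝ) (q : ℕ) (b : Cl n) (j : Fin (n + 1)) :
    partialDeriv j (wave t q b) = wave t (q - 1) ((q : ℝ) • (waveDir t j * b)) := by
  funext x
  rw [partialDeriv, (hasFDerivAt_wave t q b x).fderiv, waveDeriv_apply, waveVar_single, wave, wave,
    mul_smul_comm, ← mul_assoc, ← mul_assoc, ((commute_waveDir_waveVar t j x).pow_right _).eq]

theorem wave_smul (t : Fin n → ℝ) (q : ℕ) (b : Cl n) (c : ℝ)
    (x : EuclideanSpace ℝ (Fin (n + 1))) : wave t q b (c • x) = c ^ q • wave t q b x := by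
  rw [wave, wave, map_smul, smul_pow, smul_mul_assoc]

/-! ### The space of homogeneous monogenic polynomials -/

/-- The span of the functions `(∑ t_i z_i)^q b`. -/
def waves (n q : ℕ) : Submodule ℝ (EuclideanSpace ℝ (Fin (n + 1)) → Cl n) :=
  Submodule.span ℝ {F | ∃ t b, F = wave t q b}

theorem wave_mem_waves (t : Fin n → ℝ) (q : ℕ) (b : Cl n) : wave t q b ∈ waves n q :=
  Submodule.subset_span ⟨t, b, rfl⟩

theorem contDiff_of_mem_waves {q : ℕ} {F : EuclideanSpace ℝ (Fin (n + 1)) → Cl n}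
    (hF : F ∈ waves n q) {k : WithTop ℕ∞} : ContDiff ℝ k F := by
  induction hF using Submodule.span_induction with
  | mem F h => obtain ⟨t, b, rfl⟩ := h; exact contDiff_wave t q b
  | zero => exact contDiff_const
  | add F G _ _ hF hG => exact hF.add hG
  | smul c F _ hF => exact hF.const_smul c

theorem differentiable_of_mem_waves {q : ℕ} {F : EuclideanSpace ℝ (Fin (n + 1)) → Cl n}
    (hF : F ∈ waves n q) : Differentiable ℝ F :=
  (contDiff_of_mem_waves (k := 1) hF).differentiable one_ne_zero

theorem partialDeriv_mem_waves {q : ℕ} {F : EuclideanSpace ℝ (Fin (n + 1)) → Cl n}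
    (hF : F ∈ waves n q) (j : Fin (n + 1)) : partialDeriv j F ∈ waves n (q - 1) := by
  induction hF using Submodule.span_induction with
  | mem F h =>
    obtain ⟨t, b, rfl⟩ := h
    rw [partialDeriv_wave]
    exact wave_mem_waves _ _ _
  | zero => rw [partialDeriv_zero]; exact zero_mem _
  | add F G hF' hG' hF hG =>
    rw [partialDeriv_add (differentiable_of_mem_waves hF') (differentiable_of_mem_waves hG')]
    exact add_mem hF hG
  | smul c F hF' hF =>
    rw [partialDeriv_const_smul (differentiable_of_mem_waves hF')]
    exact Submodule.smul_mem _ _ hF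

theorem smul_of_mem_waves {q : ℕ} {F : EuclideanSpace ℝ (Fin (n + 1)) → Cl n}
    (hF : F ∈ waves n q) (c : ℝ) (x : EuclideanSpace ℝ (Fin (n + 1))) :
    F (c • x) = c ^ q • F x := by
  induction hF using Submodule.span_induction with
  | mem F h => obtain ⟨t, b, rfl⟩ := h; exact wave_smul t q b c x
  | zero => simp
  | add F G _ _ hF hG => simp [hF, hG]
  | smul d F _ hF => simp [hF, smul_comm d]

theorem sum_smul_partialDeriv_of_mem_waves {q : ℕ} {F : EuclideanSpace ℝ (Fin (n + 1)) → Cl n}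
    (hF : F ∈ waves n q) (x : EuclideanSpace ℝ (Fin (n + 1))) :
    ∑ j, x j • partialDeriv j F x = (q : ℝ) • F x := by
  rw [← fderiv_apply_eq_sum_partialDeriv]
  induction hF using Submodule.span_induction with
  | mem F h =>
    obtain ⟨t, b, rfl⟩ := h
    rw [(hasFDerivAt_wave t q b x).fderiv, waveDeriv_apply, waveVar_mul_smul_wave]
  | zero => simp
  | add F G hF' hG' hF hG =>
    rw [fderiv_add (differentiable_of_mem_waves hF' x) (differentiable_of_mem_waves hG' x)]
    simp [hF, hG]
  | smul d F hF' hF =>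
    rw [fderiv_const_smul (differentiable_of_mem_waves hF' x)]
    simp [hF, smul_comm d]

theorem laplacian_of_mem_waves {q : ℕ} {F : EuclideanSpace ℝ (Fin (n + 1)) → Cl n}
    (hF : F ∈ waves n q) : ∑ j, partialDeriv j (partialDeriv j F) = 0 := by
  induction hF using Submodule.span_induction with
  | mem F h =>
    obtain ⟨t, b, rfl⟩ := h
    funext x
    simp only [partialDeriv_wave, Finset.sum_apply, wave, mul_smul_comm,
      ← Finset.smul_sum, ← mul_assoc]
    simp only [mul_assoc (waveVar t x ^ _)]
    rw [← Finset.mul_sum, ← Finset.sum_mul, sum_waveDir_mul_self]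
    simp
  | zero => simp [partialDeriv_zero]
  | add F G hF' hG' hF hG =>
    have h : ∀ j, partialDeriv j (partialDeriv j (F + G)) =
        partialDeriv j (partialDeriv j F) + partialDeriv j (partialDeriv j G) := fun j => by
      rw [partialDeriv_add (differentiable_of_mem_waves hF') (differentiable_of_mem_waves hG'),
        partialDeriv_add (differentiable_of_mem_waves (partialDeriv_mem_waves hF' j))
          (differentiable_of_mem_waves (partialDeriv_mem_waves hG' j))]
    simp [h, Finset.sum_add_distrib, hF, hG]
  | smul c F hF' hF =>
    have h : ∀ j, partialDeriv j (partialDeriv j (c • F)) =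
        c • partialDeriv j (partialDeriv j F) := fun j => by
      rw [partialDeriv_const_smul (differentiable_of_mem_waves hF'),
        partialDeriv_const_smul (differentiable_of_mem_waves (partialDeriv_mem_waves hF' j))]
    simp [h, ← Finset.smul_sum, hF]

theorem dirac_of_mem_waves {q : ℕ} {F : EuclideanSpace ℝ (Fin (n + 1)) → Cl n}
    (hF : F ∈ waves n q) (x : EuclideanSpace ℝ (Fin (n + 1))) :
    partialDeriv 0 F x + ∑ i : Fin n, Cl.unit i * partialDeriv i.succ F x = 0 := by
  induction hF using Submodule.span_induction with
  | mem F h =>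
    obtain ⟨t, b, rfl⟩ := h
    have h : ∀ j, partialDeriv j (wave t q b) x = (q : ℝ) • (waveDir t j * wave t (q - 1) b x) := by
      intro j
      rw [partialDeriv, (hasFDerivAt_wave t q b x).fderiv, waveDeriv_apply, waveVar_single]
    simp only [h, mul_smul_comm, ← Finset.smul_sum, ← smul_add, ← mul_assoc, ← Finset.sum_mul,
      ← add_mul]
    rw [waveDir_zero_add_sum]
    simp
  | zero => simp [partialDeriv_zero]
  | add F G hF' hG' hF hG =>
    simp only [partialDeriv_add (differentiable_of_mem_waves hF') (differentiable_of_mem_waves hG'),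
      Pi.add_apply, mul_add, Finset.sum_add_distrib]
    rw [add_add_add_comm, hF, hG, add_zero]
  | smul c F hF' hF =>
    simp only [partialDeriv_const_smul (differentiable_of_mem_waves hF'), Pi.smul_apply,
      mul_smul_comm, ← Finset.smul_sum, ← smul_add, hF, smul_zero]

theorem exists_norm_le_of_mem_waves {q : ℕ} {F : EuclideanSpace ℝ (Fin (n + 1)) → Cl n}
    (hF : F ∈ waves n q) : ∃ C : ℝ, 0 ≤ C ∧ ∀ x, ‖F x‖ ≤ C * ‖x‖ ^ q := by
  obtain ⟨C, hC⟩ := (isCompact_sphere (0 : EuclideanSpace ℝ (Fin (n + 1))) 1).exists_bound_of_continuousOn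
    (contDiff_of_mem_waves (k := 0) hF).continuous.continuousOn
  -- Homogeneity reduces `x ≠ 0` to the unit sphere; `‖F 0‖` covers `x = 0` in degree `0`, where `0
  -- ^ 0 = 1`.
  refine ⟨max C ‖F 0‖, le_max_of_le_right (norm_nonneg _), fun x => ?_⟩
  rcases eq_or_ne x 0 with rfl | hx
  · rcases eq_or_ne q 0 with rfl | hq
    · simp
    · have := smul_of_mem_waves hF 0 0
      rw [zero_smul, zero_pow hq, zero_smul] at this
      simp [this, hq]
  · have h1 : x = ‖x‖ • (‖x‖⁻¹ • x) := by
      rw [smul_smul, mul_inv_cancel₀ (norm_ne_zero_iff.2 hx), one_smul]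
    have h2 : ‖F (‖x‖⁻¹ • x)‖ ≤ C := hC _ (by simp [norm_smul, hx])
    conv_lhs => rw [h1, smul_of_mem_waves hF, norm_smul, norm_pow, norm_norm, mul_comm]
    gcongr
    exact h2.trans (le_max_left _ _)

/-! ### Fueter polynomials are spanned by waves -/

theorem wave_eq_sum_words (t : Fin n → ℝ) (q : ℕ) (b : Cl n)
    (x : EuclideanSpace ℝ (Fin (n + 1))) :
    wave t q b x = ∑ m ∈ Finset.piAntidiag Finset.univ q, (∏ i, t i ^ m i) •
      ((∑ w ∈ words q m, (List.ofFn fun k => fueterVar (w k) x).prod) * b) := by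
  have h : waveVar t x ^ q = ∑ w : Fin q → Fin n,
      (∏ k, t (w k)) • (List.ofFn fun k => fueterVar (w k) x).prod := by
    rw [waveVar_eq_sum_fueterVar, ← MultilinearMap.mkPiAlgebraFin_apply_const (R := ℝ),
      MultilinearMap.map_sum]
    refine Finset.sum_congr rfl fun w _ => ?_
    rw [MultilinearMap.map_smul_univ, MultilinearMap.mkPiAlgebraFin_apply]
  rw [wave, h, ← sum_words, Finset.sum_mul]
  refine Finset.sum_congr rfl fun m _ => ?_
  rw [← smul_mul_assoc, Finset.smul_sum]
  congr 1
  refine Finset.sum_congr rfl fun w hw => ?_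
  rw [prod_comp_word, mem_words.1 hw]

/-- Up to a scalar, `V_m b` is the coefficient of `t^m` in the wave `(∑ t_i z_i)^q b`. A linear
functional killing all waves gives a polynomial in `t` that vanishes identically, hence kills each
coefficient; so no functional separates `V_m b` from the span. -/
theorem fueterPoly_mul_mem_waves {q : ℕ} {m : Fin n → ℕ} (hm : ∑ i, m i = q) (b : Cl n) :
    (fun x => fueterPoly m x * b) ∈ waves n q := by
  set S : (Fin n → ℕ) → EuclideanSpace ℝ (Fin (n + 1)) → Cl n := fun m x =>
    (∑ w ∈ words q m, (List.ofFn fun k => fueterVar (w k) x).prod) * b with hS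
  have hV : (fun x => fueterPoly m x * b) =
      (((∏ i, (m i).factorial : ℕ) : ℝ) / (q.factorial : ℝ)) • S m := by
    funext x
    rw [fueterPoly_eq hm, Pi.smul_apply, hS, smul_mul_assoc]
  rw [hV]
  refine Submodule.smul_mem _ _ ?_
  by_contra hnot
  obtain ⟨ℓ, hℓ, hker⟩ := Submodule.exists_le_ker_of_notMem hnot
  refine hℓ (eq_zero_of_sum_mul_prod_pow_eq_zero (Finset.piAntidiag Finset.univ q)
    (fun m => ℓ (S m)) (fun t => ?_) (by simpa [Finset.mem_piAntidiag] using hm))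
  have h1 : ℓ (wave t q b) = 0 := hker (wave_mem_waves t q b)
  have h2 : wave t q b = ∑ m ∈ Finset.piAntidiag Finset.univ q, (∏ i, t i ^ m i) • S m := by
    funext x
    rw [wave_eq_sum_words, Finset.sum_apply]
    rfl
  rw [h2, map_sum] at h1
  rw [← h1]
  exact Finset.sum_congr rfl fun m _ => by rw [map_smul, smul_eq_mul, mul_comm]

end

section

open MeasureTheory

variable {n : ℕ}

/-! ### Gaussian integrals and integration by parts -/

/-- The Gaussian weight. -/
def gaussWeight (x : EuclideanSpace ℝ (Fin (n + 1))) : ℝ := Real.exp (-(1 / 2) * ‖x‖ ^ 2)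

theorem gaussWeight_pos (x : EuclideanSpace ℝ (Fin (n + 1))) : 0 < gaussWeight x := Real.exp_pos _

theorem hasFDerivAt_gaussWeight (x : EuclideanSpace ℝ (Fin (n + 1))) :
    HasFDerivAt gaussWeight (-(gaussWeight x) • innerSL ℝ x) x := by
  have h := ((hasStrictFDerivAt_norm_sq x).hasFDerivAt.const_mul (-(1 / 2) : ℝ)).exp
  refine h.congr_fderiv ?_
  ext v
  simp [gaussWeight]

theorem differentiable_gaussWeight :
    Differentiable ℝ (gaussWeight : EuclideanSpace ℝ (Fin (n + 1)) → ℝ) :=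
  fun x => (hasFDerivAt_gaussWeight x).differentiableAt

theorem fderiv_gaussWeight_single (x : EuclideanSpace ℝ (Fin (n + 1))) (j : Fin (n + 1)) :
    fderiv ℝ gaussWeight x (EuclideanSpace.single j 1) = -(x j * gaussWeight x) := by
  rw [(hasFDerivAt_gaussWeight x).fderiv]
  simp [EuclideanSpace.inner_single_right, mul_comm]

theorem integrableOn_pow_mul_exp (k : ℕ) :
    IntegrableOn (fun r : ℝ => r ^ k * Real.exp (-(1 / 2) * r ^ 2)) (Set.Ioi 0) := by
  have := integrableOn_rpow_mul_exp_neg_mul_sq (b := 1 / 2) (by norm_num) (s := k)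
    (by have : (0 : ℝ) ≤ k := k.cast_nonneg
        linarith)
  simpa using this

theorem integrable_norm_pow_mul_gaussWeight (k : ℕ) :
    Integrable (fun x : EuclideanSpace ℝ (Fin (n + 1)) => ‖x‖ ^ k * gaussWeight x) := by
  refine (integrable_fun_norm_addHaar volume
    (f := fun r : ℝ => r ^ k * Real.exp (-(1 / 2) * r ^ 2))).2 ?_
  refine (integrableOn_pow_mul_exp (n + k)).congr_fun (fun r _ => ?_) measurableSet_Ioi
  simp [pow_add, mul_assoc]

theorem integrable_mul_gaussWeight {u : EuclideanSpace ℝ (Fin (n + 1)) → ℝ} (hu : Continuous u)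
    {C : ℝ} {k : ℕ} (hC : ∀ x, |u x| ≤ C * ‖x‖ ^ k) :
    Integrable (fun x => u x * gaussWeight x) := by
  refine ((integrable_norm_pow_mul_gaussWeight k).const_mul C).mono'
    (hu.mul differentiable_gaussWeight.continuous).aestronglyMeasurable (.of_forall fun x => ?_)
  rw [norm_mul, Real.norm_eq_abs, Real.norm_of_nonneg (gaussWeight_pos x).le, ← mul_assoc]
  exact mul_le_mul_of_nonneg_right (hC x) (gaussWeight_pos x).le

theorem integrable_inner_mul_gaussWeight {q k : ℕ} {F G : EuclideanSpace ℝ (Fin (n + 1)) → Cl n}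
    (hF : F ∈ waves n q) (hG : G ∈ waves n k) :
    Integrable (fun x => inner ℝ (F x) (G x) * gaussWeight x) := by
  obtain ⟨C, hC0, hC⟩ := exists_norm_le_of_mem_waves hF
  obtain ⟨D, hD0, hD⟩ := exists_norm_le_of_mem_waves hG
  refine integrable_mul_gaussWeight (C := C * D) (k := q + k)
    ((differentiable_of_mem_waves hF).continuous.inner
      (differentiable_of_mem_waves hG).continuous) fun x => ?_
  calc |inner ℝ (F x) (G x)| ≤ ‖F x‖ * ‖G x‖ := abs_real_inner_le_norm _ _
    _ ≤ (C * ‖x‖ ^ q) * (D * ‖x‖ ^ k) := by gcongr <;> simp [hC, hD]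
    _ = _ := by ring

/-- The Gaussian inner product. -/
def gaussInner (F G : EuclideanSpace ℝ (Fin (n + 1)) → Cl n) : ℝ :=
  ∫ x, inner ℝ (F x) (G x) * gaussWeight x

theorem gaussInner_comm (F G : EuclideanSpace ℝ (Fin (n + 1)) → Cl n) :
    gaussInner F G = gaussInner G F := by
  simp only [gaussInner, real_inner_comm]

theorem gaussInner_self_nonneg (F : EuclideanSpace ℝ (Fin (n + 1)) → Cl n) :
    0 ≤ gaussInner F F :=
  integral_nonneg fun x => mul_nonneg real_inner_self_nonneg (gaussWeight_pos x).le

theorem integrable_mul_inner_mul_gaussWeight {q k : ℕ}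
    {F G : EuclideanSpace ℝ (Fin (n + 1)) → Cl n}
    (hF : F ∈ waves n q) (hG : G ∈ waves n k) (j : Fin (n + 1)) :
    Integrable (fun x => x j * inner ℝ (F x) (G x) * gaussWeight x) := by
  obtain ⟨C, hC0, hC⟩ := exists_norm_le_of_mem_waves hF
  obtain ⟨D, hD0, hD⟩ := exists_norm_le_of_mem_waves hG
  have hj : Continuous fun x : EuclideanSpace ℝ (Fin (n + 1)) => x j := by fun_prop
  refine integrable_mul_gaussWeight (C := C * D) (k := q + k + 1)
    (hj.mul ((differentiable_of_mem_waves hF).continuous.inner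
      (differentiable_of_mem_waves hG).continuous)) fun x => ?_
  rw [abs_mul]
  have h1 : |x j| ≤ ‖x‖ := PiLp.norm_apply_le x j
  calc |x j| * |inner ℝ (F x) (G x)| ≤ ‖x‖ * (‖F x‖ * ‖G x‖) := by
        gcongr
        exact abs_real_inner_le_norm _ _
    _ ≤ ‖x‖ * ((C * ‖x‖ ^ q) * (D * ‖x‖ ^ k)) := by gcongr <;> simp [hC, hD]
    _ = _ := by ring

/-- Integration by parts, since `∂_j` of the Gaussian weight is `-x_j` times the weight. -/
theorem integral_mul_inner_mul_gaussWeight {q k : ℕ}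
    {F G : EuclideanSpace ℝ (Fin (n + 1)) → Cl n}
    (hF : F ∈ waves n q) (hG : G ∈ waves n k) (j : Fin (n + 1)) :
    ∫ x, x j * inner ℝ (F x) (G x) * gaussWeight x =
      gaussInner (partialDeriv j F) G + gaussInner F (partialDeriv j G) := by
  have hdF := differentiable_of_mem_waves hF
  have hdG := differentiable_of_mem_waves hG
  have hd : ∀ x, fderiv ℝ (fun x => inner ℝ (F x) (G x)) x (EuclideanSpace.single j 1) =
      inner ℝ (partialDeriv j F x) (G x) + inner ℝ (F x) (partialDeriv j G x) := by
    intro x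
    rw [fderiv_inner_apply ℝ (hdF x) (hdG x), add_comm]
    rfl
  have hi1 := integrable_inner_mul_gaussWeight (partialDeriv_mem_waves hF j) hG
  have hi2 := integrable_inner_mul_gaussWeight hF (partialDeriv_mem_waves hG j)
  have h := integral_mul_fderiv_eq_neg_fderiv_mul_of_integrable (μ := volume)
    (f := fun x => inner ℝ (F x) (G x)) (g := gaussWeight) (v := EuclideanSpace.single j (1 : ℝ))
    (by
      simp only [hd, add_mul]
      exact hi1.add hi2)
    (by
      simp only [fderiv_gaussWeight_single]
      refine (integrable_mul_inner_mul_gaussWeight hF hG j).neg.congr (.of_forall fun x => ?_)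
      simp only [Pi.neg_apply]
      ring)
    (integrable_inner_mul_gaussWeight hF hG)
    (fun x _ => (hdF x).inner ℝ (hdG x))
    (fun x _ => differentiable_gaussWeight x)
  simp only [hd, add_mul, fderiv_gaussWeight_single] at h
  rw [integral_add hi1 hi2] at h
  rw [gaussInner, gaussInner, ← neg_inj, ← h, ← integral_neg]
  congr 1
  funext x
  ring

theorem gaussInner_sum_left {ι : Type*} (s : Finset ι) {q k : ℕ}
    {F : ι → EuclideanSpace ℝ (Fin (n + 1)) → Cl n} {G : EuclideanSpace ℝ (Fin (n + 1)) → Cl n}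
    (hF : ∀ i, F i ∈ waves n q) (hG : G ∈ waves n k) :
    gaussInner (∑ i ∈ s, F i) G = ∑ i ∈ s, gaussInner (F i) G := by
  simp only [gaussInner, Finset.sum_apply, sum_inner, Finset.sum_mul]
  exact integral_finsetSum _ fun i _ => integrable_inner_mul_gaussWeight (hF i) hG

/-- Euler's identity replaces `q F` by `∑ x_j ∂_j F`; integrating by parts leaves `⟨ΔF, G⟩ + ∑ ⟨∂_j
F, ∂_j G⟩`, and `ΔF = 0`. -/
theorem mul_gaussInner {q k : ℕ} {F G : EuclideanSpace ℝ (Fin (n + 1)) → Cl n}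
    (hF : F ∈ waves n q) (hG : G ∈ waves n k) :
    q * gaussInner F G = ∑ j, gaussInner (partialDeriv j F) (partialDeriv j G) := by
  have h1 : ∑ j, gaussInner (partialDeriv j (partialDeriv j F)) G = 0 := by
    rw [← gaussInner_sum_left _
      (fun j => partialDeriv_mem_waves (partialDeriv_mem_waves hF j) j) hG,
      laplacian_of_mem_waves hF]
    simp [gaussInner]
  rw [← zero_add (∑ j, gaussInner (partialDeriv j F) (partialDeriv j G)), ← h1,
    ← Finset.sum_add_distrib]
  simp only [← integral_mul_inner_mul_gaussWeight (partialDeriv_mem_waves hF _) hG]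
  rw [← integral_finsetSum _ fun j _ =>
    integrable_mul_inner_mul_gaussWeight (partialDeriv_mem_waves hF j) hG j, gaussInner,
    ← integral_const_mul]
  congr 1
  funext x
  have h2 := congrArg (fun y => inner ℝ y (G x)) (sum_smul_partialDeriv_of_mem_waves hF x)
  simp only [sum_inner, real_inner_smul_left] at h2
  rw [← mul_assoc, ← h2, Finset.sum_mul]

/-- The right side of `mul_gaussInner` is symmetric in `F` and `G`, so `q⟨F,G⟩ = k⟨F,G⟩`. -/
theorem gaussInner_eq_zero {q k : ℕ} (hqk : q ≠ k) {F G : EuclideanSpace ℝ (Fin (n + 1)) → Cl n}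
    (hF : F ∈ waves n q) (hG : G ∈ waves n k) : gaussInner F G = 0 := by
  have h1 := mul_gaussInner hF hG
  have h2 := mul_gaussInner hG hF
  simp only [gaussInner_comm G, gaussInner_comm (partialDeriv _ G)] at h2
  have h3 : ((q : ℝ) - k) * gaussInner F G = 0 := by rw [sub_mul, h1, h2, sub_self]
  exact (mul_eq_zero.1 h3).resolve_left (sub_ne_zero.2 (by exact_mod_cast hqk))

/-! ### Polar coordinates -/

/-- The radial factor in the Gaussian integral of a homogeneous function of degree `k`. -/
def radialIntegral (n k : ℕ) : ℝ :=
  ∫ r in Set.Ioi (0 : ℝ), r ^ (n + k) * Real.exp (-(1 / 2) * r ^ 2)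

theorem radialIntegral_eq (n k : ℕ) : radialIntegral n k =
    (1 / 2 : ℝ) ^ (-((n + k : ℕ) + 1 : ℝ) / 2) * (1 / 2) * Real.Gamma (((n + k : ℕ) + 1) / 2) := by
  rw [← integral_rpow_mul_exp_neg_mul_rpow (by norm_num) (by
    have : (0 : ℝ) ≤ (n + k : ℕ) := Nat.cast_nonneg _
    linarith) (by norm_num)]
  simp only [radialIntegral, Real.rpow_natCast, Real.rpow_two]

theorem radialIntegral_pos (n k : ℕ) : 0 < radialIntegral n k := by
  rw [radialIntegral_eq]
  have := Real.Gamma_pos_of_pos (s := ((n + k : ℕ) + 1) / 2) (by positivity)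
  positivity

theorem radialIntegral_add_two (n k : ℕ) :
    radialIntegral n (k + 2) = (n + k + 1) * radialIntegral n k := by
  rw [radialIntegral_eq, radialIntegral_eq]
  have h1 : (((n + (k + 2) : ℕ) : ℝ) + 1) / 2 = ((n + k : ℕ) + 1) / 2 + 1 := by
    push_cast; ring
  have h2 : -(((n + (k + 2) : ℕ) : ℝ) + 1) / 2 = -((n + k : ℕ) + 1) / 2 + (-1) := by
    push_cast; ring
  rw [h1, h2, Real.Gamma_add_one (by positivity), Real.rpow_add (by norm_num), Real.rpow_neg_one]
  push_cast
  ring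

theorem radialIntegral_two_mul_le (n q : ℕ) :
    radialIntegral n (2 * q) ≤ 2 ^ q * ((n + q).factorial : ℝ) * radialIntegral n 0 := by
  induction q with
  | zero =>
    have h1 : (1 : ℝ) ≤ n.factorial := by exact_mod_cast n.factorial_pos
    have := mul_le_mul_of_nonneg_right h1 (radialIntegral_pos n 0).le
    simpa using this
  | succ q ih =>
    rw [mul_add, mul_one, radialIntegral_add_two]
    have h : ((n : ℝ) + (2 * q : ℕ) + 1) ≤ 2 * (n + q + 1) := by
      push_cast
      have : (0 : ℝ) ≤ n := n.cast_nonneg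
      linarith
    calc _ ≤ (2 * ((n : ℝ) + q + 1)) * (2 ^ q * ((n + q).factorial : ℝ) * radialIntegral n 0) := by
          gcongr
          exact (radialIntegral_pos _ _).le
      _ = _ := by
          rw [← add_assoc n, Nat.factorial_succ]
          push_cast
          ring

/-- The surface measure of the unit sphere. -/
def sphereMeasure (n : ℕ) : Measure (Metric.sphere (0 : EuclideanSpace ℝ (Fin (n + 1))) 1) :=
  (volume : Measure (EuclideanSpace ℝ (Fin (n + 1)))).toSphere

instance : IsFiniteMeasure (sphereMeasure n) := by unfold sphereMeasure; infer_instance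

theorem sphereMeasure_real_univ_pos : 0 < (sphereMeasure n).real Set.univ := by
  rw [sphereMeasure, Measure.toSphere_real_apply_univ]
  have : 0 < (volume : Measure (EuclideanSpace ℝ (Fin (n + 1)))).real (Metric.ball 0 1) :=
    ENNReal.toReal_pos (Metric.measure_ball_pos _ _ one_pos).ne' measure_ball_lt_top.ne
  have h2 : 0 < Module.finrank ℝ (EuclideanSpace ℝ (Fin (n + 1))) := by simp
  positivity

theorem integral_mul_gaussWeight_of_homogeneous {u : EuclideanSpace ℝ (Fin (n + 1)) → ℝ} {k : ℕ}
    (hu : ∀ (c : ℝ) x, u (c • x) = c ^ k * u x) :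
    ∫ x, u x * gaussWeight x = (∫ y, u y.1 ∂sphereMeasure n) * radialIntegral n k := by
  calc ∫ x, u x * gaussWeight x
      = ∫ x : ({(0)}ᶜ : Set (EuclideanSpace ℝ (Fin (n + 1)))), u x.1 * gaussWeight x.1
          ∂((volume : Measure (EuclideanSpace ℝ (Fin (n + 1)))).comap (↑)) := by
        rw [integral_subtype_comap (measurableSet_singleton _).compl
          fun x => u x * gaussWeight x, restrict_compl_singleton]
    _ = ∫ z, u z.1.1 * (z.2.1 ^ k * Real.exp (-(1 / 2) * z.2.1 ^ 2))
          ∂(sphereMeasure n).prod (.volumeIoiPow n) := by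
        have hmp := (volume : Measure (EuclideanSpace ℝ (Fin (n + 1)))).measurePreserving_homeomorphUnitSphereProd
        rw [finrank_euclideanSpace_fin, Nat.add_sub_cancel] at hmp
        rw [sphereMeasure, ← hmp.integral_comp (Homeomorph.measurableEmbedding _)]
        congr 1
        funext x
        have hx : ‖x.1‖ ≠ 0 := norm_ne_zero_iff.2 x.2
        have h1 := hu ‖x.1‖ (‖x.1‖⁻¹ • x.1)
        rw [smul_smul, mul_inv_cancel₀ hx, one_smul] at h1
        simp only [homeomorphUnitSphereProd_apply_fst_coe, homeomorphUnitSphereProd_apply_snd_coe]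
        rw [h1, gaussWeight]
        ring
    _ = (∫ y, u y.1 ∂sphereMeasure n) *
          ∫ r, r.1 ^ k * Real.exp (-(1 / 2) * r.1 ^ 2) ∂(.volumeIoiPow n) :=
        integral_prod_mul (fun y : Metric.sphere (0 : EuclideanSpace ℝ (Fin (n + 1))) 1 => u y.1)
          (fun r : Set.Ioi (0 : ℝ) => r.1 ^ k * Real.exp (-(1 / 2) * r.1 ^ 2))
    _ = _ := by
        congr 1
        simp only [Measure.volumeIoiPow, ENNReal.ofReal]
        rw [integral_withDensity_eq_integral_smul,
          integral_subtype_comap measurableSet_Ioi fun a : ℝ =>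
            Real.toNNReal (a ^ n) • (a ^ k * Real.exp (-(1 / 2) * a ^ 2)), radialIntegral]
        · refine setIntegral_congr_fun measurableSet_Ioi fun r hr => ?_
          rw [NNReal.smul_def, Real.coe_toNNReal _ (pow_nonneg (le_of_lt hr) _), smul_eq_mul]
          ring
        · exact (measurable_subtype_coe.pow_const _).real_toNNReal

theorem gaussInner_eq_integral_sphere {q k : ℕ} {F G : EuclideanSpace ℝ (Fin (n + 1)) → Cl n}
    (hF : F ∈ waves n q) (hG : G ∈ waves n k) :
    gaussInner F G =
      (∫ y, inner ℝ (F y.1) (G y.1) ∂sphereMeasure n) * radialIntegral n (q + k) := by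
  refine integral_mul_gaussWeight_of_homogeneous (u := fun x => inner ℝ (F x) (G x)) fun c x => ?_
  rw [smul_of_mem_waves hF, smul_of_mem_waves hG, real_inner_smul_left, real_inner_smul_right,
    pow_add, mul_assoc]

theorem integral_sphere_inner_eq_zero {q k : ℕ} (hqk : q ≠ k)
    {F G : EuclideanSpace ℝ (Fin (n + 1)) → Cl n} (hF : F ∈ waves n q) (hG : G ∈ waves n k) :
    ∫ y, inner ℝ (F y.1) (G y.1) ∂sphereMeasure n = 0 := by
  have h := gaussInner_eq_integral_sphere hF hG
  rw [gaussInner_eq_zero hqk hF hG] at h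
  exact (mul_eq_zero.1 h.symm).resolve_right (radialIntegral_pos _ _).ne'

theorem integral_gaussWeight :
    ∫ x : EuclideanSpace ℝ (Fin (n + 1)), gaussWeight x =
      (sphereMeasure n).real Set.univ * radialIntegral n 0 := by
  have := integral_mul_gaussWeight_of_homogeneous (n := n) (u := fun _ => 1) (k := 0) (by simp)
  simpa using this

end

section

open MeasureTheory

variable {n : ℕ}

/-! ### A lower bound for the Gaussian norm -/

theorem sum_piAntidiag_add_single {M : Type*} [AddCommMonoid M] (q : ℕ) (i : Fin n)
    (T : (Fin n → ℕ) → M) (hT : ∀ m, m i = 0 → T m = 0) :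
    ∑ m ∈ Finset.piAntidiag Finset.univ q, T (m + Pi.single i 1) =
      ∑ m ∈ Finset.piAntidiag Finset.univ (q + 1), T m := by
  refine Finset.sum_of_injOn (fun m => m + Pi.single i 1) (fun a _ b _ h => add_right_cancel h)
    (fun m hm => ?_) (fun m hm hne => ?_) fun m _ => rfl
  · simp only [Finset.mem_coe, Finset.mem_piAntidiag] at hm ⊢
    simp [Finset.sum_add_distrib, hm.1]
  · refine hT m (by_contra fun hmi => hne ⟨m - Pi.single i 1, ?_, ?_⟩)
    · have h1 : m - Pi.single i 1 + Pi.single i 1 = m := by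
        refine tsub_add_cancel_of_le fun k => ?_
        by_cases hk : k = i
        · subst hk; simpa using Nat.one_le_iff_ne_zero.2 hmi
        · simp [hk]
      have h2 : ∑ k, m k = q + 1 := by simpa [Finset.mem_piAntidiag] using hm
      rw [← h1] at h2
      have h3 : ∑ k, (m - Pi.single i 1 : Fin n → ℕ) k = q := by
        simpa [Finset.sum_add_distrib] using h2
      simpa [Finset.mem_piAntidiag] using h3
    · refine tsub_add_cancel_of_le fun k => ?_
      by_cases hk : k = i
      · subst hk; simpa using Nat.one_le_iff_ne_zero.2 hmi
      · simp [hk]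

theorem prod_factorial_add_single (m : Fin n → ℕ) (i : Fin n) :
    ∏ k, ((m + Pi.single i 1 : Fin n → ℕ) k).factorial = (m i + 1) * ∏ k, (m k).factorial := by
  rw [← Finset.mul_prod_erase _ _ (Finset.mem_univ i),
    ← Finset.mul_prod_erase Finset.univ (fun k => (m k).factorial) (Finset.mem_univ i), ← mul_assoc]
  congr 1
  · simp [Nat.factorial_succ]
  · refine Finset.prod_congr rfl fun k hk => ?_
    simp [(Finset.mem_erase.1 hk).1]

/-- Since `(m + e_i)! = (m_i + 1) m!`, shifting the index leaves one weight `m_i`, and these add up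
to `q + 1`. This is the combinatorial half of the induction in
`sum_factorial_mul_norm_sq_le_gaussInner`. -/
theorem sum_sum_factorial_mul_sq (q : ℕ) (g : (Fin n → ℕ) → ℝ) :
    ∑ i : Fin n, ∑ m ∈ Finset.piAntidiag Finset.univ q,
      ((∏ k, (m k).factorial : ℕ) : ℝ) * (((m i : ℝ) + 1) ^ 2 * g (m + Pi.single i 1)) =
    (q + 1) * ∑ m ∈ Finset.piAntidiag Finset.univ (q + 1),
      ((∏ k, (m k).factorial : ℕ) : ℝ) * g m := by
  have h1 : ∀ i : Fin n, ∑ m ∈ Finset.piAntidiag Finset.univ q,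
      ((∏ k, (m k).factorial : ℕ) : ℝ) * (((m i : ℝ) + 1) ^ 2 * g (m + Pi.single i 1)) =
      ∑ m ∈ Finset.piAntidiag Finset.univ (q + 1),
        (m i : ℝ) * (((∏ k, (m k).factorial : ℕ) : ℝ) * g m) := by
    intro i
    rw [← sum_piAntidiag_add_single q i _ (by intro m hm; simp [hm])]
    refine Finset.sum_congr rfl fun m _ => ?_
    rw [prod_factorial_add_single]
    simp only [Pi.add_apply, Pi.single_eq_same]
    push_cast
    ring
  simp only [h1]
  rw [Finset.sum_comm, Finset.mul_sum]
  refine Finset.sum_congr rfl fun m hm => ?_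
  rw [← Finset.sum_mul]
  congr 1
  have : ∑ k, m k = q + 1 := by simpa [Finset.mem_piAntidiag] using hm
  exact_mod_cast this

/-- The derivative is tangential to the hyperplane `x_0 = 0`, so the restriction of `F` determines
it. -/
theorem partialDeriv_succ_of_eq_sum {q : ℕ} {F : EuclideanSpace ℝ (Fin (n + 1)) → Cl n}
    (hF : Differentiable ℝ F) {c : (Fin n → ℕ) → Cl n}
    (hc : ∀ x, x 0 = 0 → F x = ∑ m ∈ Finset.piAntidiag Finset.univ (q + 1),
      (∏ i, x i.succ ^ m i) • c m) (i : Fin n)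
    (x : EuclideanSpace ℝ (Fin (n + 1))) (hx : x 0 = 0) :
    partialDeriv i.succ F x = ∑ m ∈ Finset.piAntidiag Finset.univ q,
      (∏ k, x k.succ ^ m k) • (((m i : ℝ) + 1) • c (m + Pi.single i 1)) := by
  have h1 : HasDerivAt (fun s : ℝ => F (x + s • EuclideanSpace.single i.succ 1))
      (partialDeriv i.succ F x) 0 := by
    have h := (hF x).hasFDerivAt
    have hl : HasDerivAt (fun s : ℝ => x + s • EuclideanSpace.single i.succ (1 : ℝ))
        (EuclideanSpace.single i.succ 1) 0 := by
      simpa using ((hasDerivAt_id (0 : ℝ)).smul_const (EuclideanSpace.single i.succ (1 : ℝ))).const_add x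
    exact HasFDerivAt.comp_hasDerivAt_of_eq 0 h hl (by simp)
  have h2 : ∀ s : ℝ, F (x + s • EuclideanSpace.single i.succ 1) =
      ∑ m ∈ Finset.piAntidiag Finset.univ (q + 1),
        ((x i.succ + s) ^ m i * ∏ k ∈ Finset.univ.erase i, x k.succ ^ m k) • c m := by
    intro s
    rw [hc _ (by simp [hx])]
    refine Finset.sum_congr rfl fun m _ => ?_
    rw [← Finset.mul_prod_erase _ _ (Finset.mem_univ i)]
    congr 2
    · simp
    · refine Finset.prod_congr rfl fun k hk => ?_
      have : k ≠ i := (Finset.mem_erase.1 hk).1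
      simp [this]
  have h3 : HasDerivAt (fun s : ℝ => F (x + s • EuclideanSpace.single i.succ 1))
      (∑ m ∈ Finset.piAntidiag Finset.univ (q + 1), (((m i : ℝ) * x i.succ ^ (m i - 1)) *
        ∏ k ∈ Finset.univ.erase i, x k.succ ^ m k) • c m) 0 := by
    simp only [h2]
    refine HasDerivAt.fun_sum fun m _ => ?_
    have hp : HasDerivAt (fun s : ℝ => (x i.succ + s) ^ m i)
        ((m i : ℝ) * x i.succ ^ (m i - 1)) 0 := by
      have h : HasDerivAt (fun s : ℝ => x i.succ + s) 1 0 :=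
        (hasDerivAt_id (0 : ℝ)).const_add (x i.succ)
      simpa using h.fun_pow (m i)
    exact (hp.mul_const _).smul_const _
  rw [h1.unique h3, ← sum_piAntidiag_add_single q i _ (by intro m hm; simp [hm])]
  refine Finset.sum_congr rfl fun m _ => ?_
  rw [smul_smul, ← Finset.mul_prod_erase _ _ (Finset.mem_univ i)]
  congr 1
  have : ∏ k ∈ Finset.univ.erase i, x k.succ ^ (m + Pi.single i 1 : Fin n → ℕ) k =
      ∏ k ∈ Finset.univ.erase i, x k.succ ^ m k := by
    refine Finset.prod_congr rfl fun k hk => ?_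
    simp [(Finset.mem_erase.1 hk).1]
  rw [this]
  simp only [Pi.add_apply, Pi.single_eq_same, Nat.add_sub_cancel]
  push_cast
  ring

/-- Induction on the degree through `mul_gaussInner`: discarding the nonnegative `x_0` term leaves
the derivatives `∂_i F`, whose restrictions have the coefficients `(m_i + 1) c_{m+e_i}`. -/
theorem sum_factorial_mul_norm_sq_le_gaussInner {q : ℕ}
    {F : EuclideanSpace ℝ (Fin (n + 1)) → Cl n} (hF : F ∈ waves n q) {c : (Fin n → ℕ) → Cl n}
    (hc : ∀ x, x 0 = 0 → F x = ∑ m ∈ Finset.piAntidiag Finset.univ q,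
      (∏ i, x i.succ ^ m i) • c m) :
    (∫ x : EuclideanSpace ℝ (Fin (n + 1)), gaussWeight x) *
      ∑ m ∈ Finset.piAntidiag Finset.univ q, ((∏ k, (m k).factorial : ℕ) : ℝ) * ‖c m‖ ^ 2
      ≤ gaussInner F F := by
  induction q generalizing F c with
  | zero =>
    have hconst : ∀ x, F x = c 0 := by
      intro x
      have h1 := smul_of_mem_waves hF 0 x
      rw [zero_smul, pow_zero, one_smul] at h1
      rw [← h1, hc 0 (by simp)]
      simp
    simp only [gaussInner, hconst, real_inner_self_eq_norm_sq]
    rw [integral_const_mul]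
    simp [mul_comm]
  | succ q ih =>
    have h1 := mul_gaussInner hF hF
    have h2 : ∑ i : Fin n, gaussInner (partialDeriv i.succ F) (partialDeriv i.succ F) ≤
        ((q + 1 : ℕ) : ℝ) * gaussInner F F := by
      rw [h1, Fin.sum_univ_succ]
      exact le_add_of_nonneg_left (gaussInner_self_nonneg _)
    have h3 : ∀ i : Fin n, (∫ x : EuclideanSpace ℝ (Fin (n + 1)), gaussWeight x) *
        ∑ m ∈ Finset.piAntidiag Finset.univ q, ((∏ k, (m k).factorial : ℕ) : ℝ) *
          (((m i : ℝ) + 1) ^ 2 * ‖c (m + Pi.single i 1)‖ ^ 2) ≤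
        gaussInner (partialDeriv i.succ F) (partialDeriv i.succ F) := by
      intro i
      have := ih (F := partialDeriv i.succ F)
        (c := fun m => ((m i : ℝ) + 1) • c (m + Pi.single i 1))
        (partialDeriv_mem_waves hF _)
        (partialDeriv_succ_of_eq_sum (differentiable_of_mem_waves hF) hc i)
      simpa only [norm_smul, mul_pow, Real.norm_eq_abs, sq_abs] using this
    have h4 := (Finset.sum_le_sum fun i _ => h3 i).trans h2
    rw [← Finset.mul_sum, sum_sum_factorial_mul_sq q fun m => ‖c m‖ ^ 2] at h4
    have h5 : (0 : ℝ) < (q + 1 : ℕ) := by positivity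
    refine le_of_mul_le_mul_left ?_ h5
    refine le_trans (le_of_eq ?_) h4
    push_cast
    ring

/-! ### The homogeneous parts of an expansion -/

/-- The homogeneous part of degree `q` of `∑ V_m a_m`. -/
def homPart (a : (Fin n → ℕ) → Cl n) (q : ℕ) (x : EuclideanSpace ℝ (Fin (n + 1))) : Cl n :=
  ∑ m ∈ Finset.piAntidiag Finset.univ q, fueterPoly m x * a m

theorem sum_eq_of_mem_piAntidiag {q : ℕ} {m : Fin n → ℕ}
    (hm : m ∈ Finset.piAntidiag Finset.univ q) : ∑ i, m i = q := by
  simpa [Finset.mem_piAntidiag] using hm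

theorem mem_piAntidiag_of_sum_eq {q : ℕ} {m : Fin n → ℕ} (hm : ∑ i, m i = q) :
    m ∈ Finset.piAntidiag Finset.univ q := by
  simpa [Finset.mem_piAntidiag] using hm

theorem homPart_mem_waves (a : (Fin n → ℕ) → Cl n) (q : ℕ) : homPart a q ∈ waves n q := by
  have : homPart a q = ∑ m ∈ Finset.piAntidiag Finset.univ q, fun x => fueterPoly m x * a m := by
    funext x
    simp [homPart]
  rw [this]
  exact Submodule.sum_mem _ fun m hm => fueterPoly_mul_mem_waves (sum_eq_of_mem_piAntidiag hm) _

theorem homPart_of_zero (a : (Fin n → ℕ) → Cl n) (q : ℕ) (x : EuclideanSpace ℝ (Fin (n + 1)))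
    (hx : x 0 = 0) : homPart a q x =
      ∑ m ∈ Finset.piAntidiag Finset.univ q, (∏ i, x i.succ ^ m i) • a m := by
  simp [homPart, fueterPoly_of_zero hx]

/-- At the point `(0, R, …, R)` the `m`-th term has norm exactly `R^|m| ‖a_m‖`, so convergence at
these points alone gives absolute summability for every `R`. -/
theorem HasFueterExpansion.summable_pow_mul_norm
    {f : EuclideanSpace ℝ (Fin (n + 1)) → Cl n} {a : (Fin n → ℕ) → Cl n}
    (h : HasFueterExpansion f a) {R : ℝ} (hR : 0 ≤ R) :
    Summable fun m => R ^ (∑ i, m i) * ‖a m‖ := by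
  have h1 := (h (WithLp.toLp 2 (Fin.cons 0 fun _ => R))).summable.norm
  refine h1.congr fun m => ?_
  rw [fueterPoly_of_zero (by simp), smul_mul_assoc, one_mul, norm_smul]
  simp [Finset.prod_pow_eq_pow_sum, abs_of_nonneg hR]

/-- Integrated term by term against the degree `q` part, the expansion loses every other degree by
orthogonality on the sphere. -/
theorem pow_mul_integral_norm_sq_homPart {f : EuclideanSpace ℝ (Fin (n + 1)) → Cl n}
    {a : (Fin n → ℕ) → Cl n} (h : HasFueterExpansion f a) (q : ℕ) {r : ℝ} (hr : 0 ≤ r) :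
    ∫ y, inner ℝ (f (r • y.1)) (homPart a q y.1) ∂sphereMeasure n =
      r ^ q * ∫ y, ‖homPart a q y.1‖ ^ 2 ∂sphereMeasure n := by
  have hP := homPart_mem_waves a q
  have hPc : Continuous (homPart a q) := (differentiable_of_mem_waves hP).continuous
  obtain ⟨C, hC0, hC⟩ := exists_norm_le_of_mem_waves hP
  have hV : ∀ m : Fin n → ℕ, (fun x => fueterPoly m x * a m) ∈ waves n (∑ i, m i) :=
    fun m => fueterPoly_mul_mem_waves rfl _
  have hVc : ∀ m : Fin n → ℕ, Continuous fun x => fueterPoly m x * a m :=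
    fun m => (differentiable_of_mem_waves (hV m)).continuous
  have hcont : ∀ m : Fin n → ℕ,
      Continuous fun y : Metric.sphere (0 : EuclideanSpace ℝ (Fin (n + 1))) 1 =>
        inner ℝ (fueterPoly m y.1 * a m) (homPart a q y.1) := fun m =>
    ((hVc m).comp continuous_subtype_val).inner (hPc.comp continuous_subtype_val)
  have hhom : ∀ (m : Fin n → ℕ) x, fueterPoly m (r • x) * a m =
      r ^ (∑ i, m i) • (fueterPoly m x * a m) := fun m x => smul_of_mem_waves (hV m) r x
  have hint : ∀ m : Fin n → ℕ, Integrable (fun y => inner ℝ (fueterPoly m y.1 * a m)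
      (homPart a q y.1)) (sphereMeasure n) := fun m =>
    (hcont m).integrable_of_hasCompactSupport (HasCompactSupport.of_compactSpace _)
  have hbound : ∀ (m : Fin n → ℕ) (y : Metric.sphere (0 : EuclideanSpace ℝ (Fin (n + 1))) 1),
      ‖r ^ (∑ i, m i) * inner ℝ (fueterPoly m y.1 * a m) (homPart a q y.1)‖ ≤
        r ^ (∑ i, m i) * ‖a m‖ * C := by
    intro m y
    have hy : ‖y.1‖ = 1 := by simp
    rw [norm_mul, norm_pow, Real.norm_of_nonneg hr, mul_assoc]
    gcongr
    refine (norm_inner_le_norm _ _).trans ?_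
    have h1 := norm_fueterPoly_mul_le (m := m) rfl y.1 (a m)
    have h2 := hC y.1
    rw [hy, one_pow, one_mul] at h1
    rw [hy, one_pow, mul_one] at h2
    gcongr
  have key := hasSum_integral_of_summable_integral_norm (μ := sphereMeasure n)
    (F := fun (m : Fin n → ℕ) (y : Metric.sphere (0 : EuclideanSpace ℝ (Fin (n + 1))) 1) =>
      r ^ (∑ i, m i) * inner ℝ (fueterPoly m y.1 * a m) (homPart a q y.1))
    (fun m => (hint m).const_mul _) (by
      refine Summable.of_nonneg_of_le (fun m => integral_nonneg fun y => norm_nonneg _) (fun m => ?_)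
        (((h.summable_pow_mul_norm hr).mul_right C).mul_right ((sphereMeasure n).real Set.univ))
      refine (integral_mono (((hint m).const_mul _).norm) (integrable_const _)
        (hbound m)).trans (le_of_eq ?_)
      simp [mul_comm])
  have hsum : ∀ y : Metric.sphere (0 : EuclideanSpace ℝ (Fin (n + 1))) 1,
      ∑' m : Fin n → ℕ, r ^ (∑ i, m i) * inner ℝ (fueterPoly m y.1 * a m) (homPart a q y.1) =
        inner ℝ (f (r • y.1)) (homPart a q y.1) := by
    intro y
    have := (h (r • y.1)).mapL (innerSL ℝ (homPart a q y.1))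
    refine Eq.trans (tsum_congr fun m => ?_) (this.tsum_eq.trans
      (real_inner_comm (f (r • y.1)) (homPart a q y.1)))
    rw [hhom, innerSL_apply_apply, real_inner_smul_right, real_inner_comm]
  simp only [hsum] at key
  refine (key.unique (hasSum_sum_of_ne_finset_zero (s := Finset.piAntidiag Finset.univ q)
    fun m hm => ?_)).trans ?_
  · rw [integral_const_mul, integral_sphere_inner_eq_zero (fun hq => hm
      (mem_piAntidiag_of_sum_eq hq)) (hV m) hP, mul_zero]
  · simp only [integral_const_mul]
    rw [Finset.sum_congr rfl fun m hm => by rw [sum_eq_of_mem_piAntidiag hm], ← Finset.mul_sum,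
      ← integral_finsetSum _ fun m _ => hint m]
    congr 2
    funext y
    rw [← sum_inner, ← real_inner_self_eq_norm_sq]
    rfl

theorem integral_norm_sq_homPart_le {f : EuclideanSpace ℝ (Fin (n + 1)) → Cl n}
    {a : (Fin n → ℕ) → Cl n} (h : HasFueterExpansion f a) (hf : Continuous f) (q : ℕ) {r M : ℝ}
    (hr : 0 ≤ r) (hM : ∀ x, ‖x‖ = r → ‖f x‖ ≤ M) :
    (r ^ q) ^ 2 * ∫ y, ‖homPart a q y.1‖ ^ 2 ∂sphereMeasure n ≤
      M ^ 2 * (sphereMeasure n).real Set.univ := by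
  have hPc : Continuous (homPart a q) :=
    (differentiable_of_mem_waves (homPart_mem_waves a q)).continuous
  have hc1 : Continuous fun y : Metric.sphere (0 : EuclideanSpace ℝ (Fin (n + 1))) 1 =>
      inner ℝ (f (r • y.1)) (homPart a q y.1) :=
    (hf.comp (continuous_subtype_val.const_smul r)).inner (hPc.comp continuous_subtype_val)
  have hc2 : Continuous fun y : Metric.sphere (0 : EuclideanSpace ℝ (Fin (n + 1))) 1 =>
      ‖homPart a q y.1‖ ^ 2 := (hPc.comp continuous_subtype_val).norm.pow 2
  have hi1 : Integrable _ (sphereMeasure n) :=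
    hc1.integrable_of_hasCompactSupport (HasCompactSupport.of_compactSpace _)
  have hi2 : Integrable _ (sphereMeasure n) :=
    hc2.integrable_of_hasCompactSupport (HasCompactSupport.of_compactSpace _)
  -- Pointwise `2ab ≤ a² + b²` replaces Cauchy–Schwarz for integrals; the left side equals `2 r^{2q}
  -- ∫ ‖P_q‖²`, half of which is absorbed.
  have h1 : ∫ y, 2 * r ^ q * inner ℝ (f (r • y.1)) (homPart a q y.1) ∂sphereMeasure n ≤
      ∫ y, (M ^ 2 + (r ^ q) ^ 2 * ‖homPart a q y.1‖ ^ 2) ∂sphereMeasure n := by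
    refine integral_mono (hi1.const_mul _) ((integrable_const _).add (hi2.const_mul _)) fun y => ?_
    have hy : ‖f (r • y.1)‖ ≤ M := hM _ (by simp [norm_smul, abs_of_nonneg hr])
    have h2 := real_inner_le_norm (f (r • y.1)) (homPart a q y.1)
    have h3 : inner ℝ (f (r • y.1)) (homPart a q y.1) ≤ M * ‖homPart a q y.1‖ :=
      h2.trans (by gcongr)
    have h4 : 0 ≤ r ^ q := by positivity
    have h5 := mul_le_mul_of_nonneg_left h3 h4
    nlinarith [sq_nonneg (M - r ^ q * ‖homPart a q y.1‖)]
  rw [integral_const_mul, pow_mul_integral_norm_sq_homPart h q hr,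
    integral_add (integrable_const _) (hi2.const_mul _), integral_const_mul] at h1
  simp only [integral_const, smul_eq_mul] at h1
  nlinarith

/-! ### Cauchy estimates -/

theorem norm_sq_mul_measure_le (hn : 2 ≤ n) (a : (Fin n → ℕ) → Cl n) {q : ℕ} {m : Fin n → ℕ}
    (hm : ∑ i, m i = q) :
    ‖a m‖ ^ 2 * (sphereMeasure n).real Set.univ ≤
      ((n : ℝ) + q) ^ n * ((n : ℝ) ^ q) ^ 2 * ∫ y, ‖homPart a q y.1‖ ^ 2 ∂sphereMeasure n := by
  have hP := homPart_mem_waves a q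
  have h1 := sum_factorial_mul_norm_sq_le_gaussInner hP (homPart_of_zero a q)
  rw [gaussInner_eq_integral_sphere hP hP, integral_gaussWeight, ← two_mul q] at h1
  simp only [real_inner_self_eq_norm_sq] at h1
  have h2 := Finset.single_le_sum
    (f := fun m : Fin n → ℕ => ((∏ k, (m k).factorial : ℕ) : ℝ) * ‖a m‖ ^ 2)
    (fun m _ => by positivity) (mem_piAntidiag_of_sum_eq hm)
  set I := ∫ y, ‖homPart a q y.1‖ ^ 2 ∂sphereMeasure n with hI
  have hI0 : 0 ≤ I := integral_nonneg fun y => by positivity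
  set S := (sphereMeasure n).real Set.univ
  have hS : 0 < S := sphereMeasure_real_univ_pos
  have hR : 0 < radialIntegral n 0 := radialIntegral_pos n 0
  have hm0 : (0 : ℝ) < ((∏ k, (m k).factorial : ℕ) : ℝ) := by
    exact_mod_cast Finset.prod_pos fun k _ => (m k).factorial_pos
  have h3 : S * radialIntegral n 0 * (((∏ k, (m k).factorial : ℕ) : ℝ) * ‖a m‖ ^ 2) ≤
      I * (2 ^ q * ((n + q).factorial : ℝ) * radialIntegral n 0) :=
    (mul_le_mul_of_nonneg_left h2 (by positivity)).trans
      (h1.trans (mul_le_mul_of_nonneg_left (radialIntegral_two_mul_le n q) hI0))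
  have h4 : ((n + q).factorial : ℝ) ≤ ((n : ℝ) + q) ^ n * q.factorial := by
    have : (n + q).factorial ≤ (n + q) ^ n * q.factorial := by
      rw [add_comm n q, ← Nat.factorial_mul_ascFactorial, mul_comm]
      exact Nat.mul_le_mul_right _ (Nat.ascFactorial_le_pow_add _ _)
    exact_mod_cast this
  have h5 := factorial_le_pow_mul_prod_factorial hm
  -- The `2^q` from the radial integral is absorbed into `n^q`; this needs `n ≥ 2`.
  have h6 : (2 : ℝ) ^ q * (n : ℝ) ^ q ≤ ((n : ℝ) ^ q) ^ 2 := by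
    have : (2 : ℝ) ≤ n := by exact_mod_cast hn
    rw [sq]
    gcongr
  have h7 : 2 ^ q * ((n + q).factorial : ℝ) ≤
      ((n : ℝ) + q) ^ n * ((n : ℝ) ^ q) ^ 2 * ((∏ k, (m k).factorial : ℕ) : ℝ) := by
    calc 2 ^ q * ((n + q).factorial : ℝ) ≤ 2 ^ q * (((n : ℝ) + q) ^ n *
          ((n : ℝ) ^ q * ((∏ k, (m k).factorial : ℕ) : ℝ))) := by
          gcongr
          exact h4.trans (by gcongr)
      _ = ((n : ℝ) + q) ^ n * (2 ^ q * (n : ℝ) ^ q) * ((∏ k, (m k).factorial : ℕ) : ℝ) := by ring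
      _ ≤ _ := by gcongr
  have h8 : I * (2 ^ q * ((n + q).factorial : ℝ) * radialIntegral n 0) ≤
      I * ((((n : ℝ) + q) ^ n * ((n : ℝ) ^ q) ^ 2 * ((∏ k, (m k).factorial : ℕ) : ℝ)) *
        radialIntegral n 0) := by gcongr
  refine le_of_mul_le_mul_right ?_ (mul_pos hR hm0)
  calc _ = S * radialIntegral n 0 * (((∏ k, (m k).factorial : ℕ) : ℝ) * ‖a m‖ ^ 2) := by ring
    _ ≤ _ := h3.trans h8
    _ = _ := by ring

/-- With one imaginary unit `V_m` is a power of a single complex variable, so norms are exact. This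
replaces the Gaussian estimate, whose factor `2^q` would be too large for `n = 1`. -/
theorem norm_fueterPoly_mul_of_one {q : ℕ} {m : Fin 1 → ℕ} (hm : ∑ i, m i = q)
    (x : EuclideanSpace ℝ (Fin (1 + 1))) (b : Cl 1) :
    ‖fueterPoly m x * b‖ = ‖x‖ ^ q * ‖b‖ := by
  have h1 : fueterPoly m x = fueterVar 0 x ^ q := by
    rw [fueterPoly_eq hm, Finset.sum_congr rfl (g := fun _ => fueterVar 0 x ^ q) fun w _ => ?_,
      Finset.sum_const, ← Nat.cast_smul_eq_nsmul ℝ, smul_smul, card_words_eq hm, one_smul]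
    rw [Subsingleton.elim w fun _ => 0]
    simp
  have h2 : ∀ y : Cl 1, ‖fueterVar 0 x * y‖ = ‖x‖ * ‖y‖ := by
    intro y
    refine (sq_eq_sq₀ (by positivity) (by positivity)).1 ?_
    rw [norm_fueterVar_mul_sq, mul_pow, EuclideanSpace.norm_sq_eq, Fin.sum_univ_two]
    simp [add_comm]
  rw [h1]
  clear hm h1
  induction q with
  | zero => simp
  | succ q ih => rw [pow_succ', mul_assoc, h2, ih, pow_succ', mul_assoc]

theorem norm_sq_mul_measure_eq_of_one (a : (Fin 1 → ℕ) → Cl 1) {q : ℕ} {m : Fin 1 → ℕ}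
    (hm : ∑ i, m i = q) :
    ‖a m‖ ^ 2 * (sphereMeasure 1).real Set.univ =
      ∫ y, ‖homPart a q y.1‖ ^ 2 ∂sphereMeasure 1 := by
  have h : ∀ y : Metric.sphere (0 : EuclideanSpace ℝ (Fin (1 + 1))) 1,
      ‖homPart a q y.1‖ = ‖a m‖ := by
    intro y
    rw [homPart, Finset.sum_eq_single m, norm_fueterPoly_mul_of_one hm]
    · simp
    · intro m' hm' hne
      refine (hne (funext fun i => ?_)).elim
      have := sum_eq_of_mem_piAntidiag hm'
      rw [Fin.sum_univ_one] at this hm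
      rw [Subsingleton.elim i 0, this, hm]
    · exact fun h => (h (mem_piAntidiag_of_sum_eq hm)).elim
  simp [h, mul_comm]

/-- Cauchy's estimate for the Fueter coefficients. -/
theorem HasFueterExpansion.norm_mul_pow_le (hn : 1 ≤ n)
    {f : EuclideanSpace ℝ (Fin (n + 1)) → Cl n} {a : (Fin n → ℕ) → Cl n}
    (h : HasFueterExpansion f a) (hf : Continuous f) {q : ℕ} {m : Fin n → ℕ} (hm : ∑ i, m i = q)
    {r M : ℝ} (hr : 0 ≤ r) (hM0 : 0 ≤ M) (hM : ∀ x, ‖x‖ = r → ‖f x‖ ≤ M) :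
    ‖a m‖ * r ^ q ≤ ((n : ℝ) + q) ^ n * (n : ℝ) ^ q * M := by
  have h1 := integral_norm_sq_homPart_le h hf q hr hM
  have hS := sphereMeasure_real_univ_pos (n := n)
  have hI0 : 0 ≤ ∫ y, ‖homPart a q y.1‖ ^ 2 ∂sphereMeasure n :=
    integral_nonneg fun y => by positivity
  have hn1 : (1 : ℝ) ≤ n := by exact_mod_cast hn
  have hnq : (1 : ℝ) ≤ (n : ℝ) + q := le_add_of_le_of_nonneg hn1 q.cast_nonneg
  have h2 : ‖a m‖ ^ 2 * (sphereMeasure n).real Set.univ ≤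
      ((n : ℝ) + q) ^ n * ((n : ℝ) ^ q) ^ 2 * ∫ y, ‖homPart a q y.1‖ ^ 2 ∂sphereMeasure n := by
    rcases hn.eq_or_lt with rfl | hn2
    · rw [norm_sq_mul_measure_eq_of_one a hm]
      refine le_mul_of_one_le_left hI0 ?_
      simp
    · exact norm_sq_mul_measure_le hn2 a hm
  -- The polynomial factor is squared so that the whole bound is a perfect square; its `q`-th root
  -- tends to `1` anyway.
  have h3 : ((n : ℝ) + q) ^ n ≤ (((n : ℝ) + q) ^ n) ^ 2 :=
    le_self_pow₀ (one_le_pow₀ hnq) two_ne_zero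
  refine le_of_sq_le_sq ?_ (by positivity)
  refine le_of_mul_le_mul_right ?_ hS
  calc (‖a m‖ * r ^ q) ^ 2 * (sphereMeasure n).real Set.univ
      = (‖a m‖ ^ 2 * (sphereMeasure n).real Set.univ) * (r ^ q) ^ 2 := by ring
    _ ≤ (((n : ℝ) + q) ^ n * ((n : ℝ) ^ q) ^ 2 *
          ∫ y, ‖homPart a q y.1‖ ^ 2 ∂sphereMeasure n) * (r ^ q) ^ 2 := by gcongr
    _ = ((n : ℝ) + q) ^ n * ((n : ℝ) ^ q) ^ 2 * ((r ^ q) ^ 2 *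
          ∫ y, ‖homPart a q y.1‖ ^ 2 ∂sphereMeasure n) := by ring
    _ ≤ (((n : ℝ) + q) ^ n) ^ 2 * ((n : ℝ) ^ q) ^ 2 *
          (M ^ 2 * (sphereMeasure n).real Set.univ) := by gcongr
    _ = _ := by ring

end

section

open Filter Topology

variable {n : ℕ}

/-! ### Termwise differentiation of Fueter expansions -/

theorem hasFDerivAt_prod_fueterVar_mul {q : ℕ} (w : Fin q → Fin n) (b : Cl n)
    (x : EuclideanSpace ℝ (Fin (n + 1))) :
    ∃ L : EuclideanSpace ℝ (Fin (n + 1)) →L[ℝ] Cl n,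
      HasFDerivAt (fun x => (List.ofFn fun k => fueterVar (w k) x).prod * b) L x ∧
        ∀ v, ‖L v‖ ≤ q * (1 + ‖x‖) ^ q * ‖b‖ * ‖v‖ := by
  induction q with
  | zero => exact ⟨0, by simpa using hasFDerivAt_const b x, by simp⟩
  | succ q ih =>
    obtain ⟨L, hL, hLn⟩ := ih fun k => w k.succ
    -- Viewing the leading Fueter variable as a continuous linear map makes the bilinear product
    -- rule available.
    have hz : ∀ x, fueterVar (w 0) x = (waveVar (Pi.single (w 0) 1)).toContinuousLinearMap x := by
      intro x
      rw [LinearMap.coe_toContinuousLinearMap', waveVar_eq_sum_fueterVar,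
        Finset.sum_eq_single (w 0)] <;> simp +contextual
    have h1 : (fun x => (List.ofFn fun k => fueterVar (w k) x).prod * b) = fun x =>
        Cl.mulL n ((waveVar (Pi.single (w 0) 1)).toContinuousLinearMap x)
          ((List.ofFn fun k : Fin q => fueterVar (w k.succ) x).prod * b) := by
      funext x
      rw [List.ofFn_succ, List.prod_cons, mul_assoc, Cl.mulL_apply, ← hz]
    rw [h1]
    refine ⟨_, (Cl.mulL n).hasFDerivAt_of_bilinear
      ((waveVar (Pi.single (w 0) 1)).toContinuousLinearMap.hasFDerivAt (x := x)) hL, fun v => ?_⟩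
    have h2 : ‖fueterVar (w 0) x * L v‖ ≤
        (1 + ‖x‖) * (q * (1 + ‖x‖) ^ q * ‖b‖ * ‖v‖) := by
      refine (norm_fueterVar_mul_le _ _ _).trans ?_
      gcongr
      · linarith
      · exact hLn v
    have h3 : ‖fueterVar (w 0) v * ((List.ofFn fun k : Fin q => fueterVar (w k.succ) x).prod * b)‖ ≤
        ‖v‖ * ((1 + ‖x‖) ^ (q + 1) * ‖b‖) := by
      refine (norm_fueterVar_mul_le _ _ _).trans ?_
      gcongr
      refine (norm_prod_fueterVar_mul_le _ _ _).trans ?_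
      gcongr
      refine (pow_le_pow_left₀ (norm_nonneg x) (by linarith) q).trans
        (pow_le_pow_right₀ (by linarith [norm_nonneg x]) q.le_succ)
    rw [hz] at h2 h3
    refine (norm_add_le_of_le h2 h3).trans (le_of_eq ?_)
    push_cast
    ring

theorem norm_fderiv_fueterPoly_mul_le {q : ℕ} {m : Fin n → ℕ} (hm : ∑ i, m i = q) (b : Cl n)
    (x : EuclideanSpace ℝ (Fin (n + 1))) :
    ‖fderiv ℝ (fun x => fueterPoly m x * b) x‖ ≤ (2 * (1 + ‖x‖)) ^ q * ‖b‖ := by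
  choose L hL hLn using fun w : Fin q → Fin n => hasFDerivAt_prod_fueterVar_mul w b x
  have h1 : (fun x => fueterPoly m x * b) = fun x =>
      (((∏ i, (m i).factorial : ℕ) : ℝ) / (q.factorial : ℝ)) •
        ∑ w ∈ words q m, (List.ofFn fun k => fueterVar (w k) x).prod * b := by
    funext x
    rw [fueterPoly_eq hm, smul_mul_assoc, Finset.sum_mul]
  rw [h1, ((HasFDerivAt.fun_sum (u := words q m) fun w _ => hL w).fun_const_smul _).fderiv, norm_smul,
    Real.norm_of_nonneg (by positivity)]
  have h2 : ∀ w ∈ words q m, ‖L w‖ ≤ (2 * (1 + ‖x‖)) ^ q * ‖b‖ := by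
    intro w _
    refine ContinuousLinearMap.opNorm_le_bound _ (by positivity) fun v => (hLn w v).trans ?_
    gcongr
    rw [mul_pow]
    gcongr
    exact_mod_cast Nat.lt_two_pow_self.le
  calc _ ≤ (((∏ i, (m i).factorial : ℕ) : ℝ) / (q.factorial : ℝ)) *
        ∑ w ∈ words q m, (2 * (1 + ‖x‖)) ^ q * ‖b‖ := by
        gcongr
        exact (norm_sum_le _ _).trans (Finset.sum_le_sum h2)
    _ = _ := by
        rw [Finset.sum_const, nsmul_eq_mul, ← mul_assoc, card_words_eq hm, one_mul]

theorem HasFueterExpansion.isMonogenic {f : EuclideanSpace ℝ (Fin (n + 1)) → Cl n}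
    {a : (Fin n → ℕ) → Cl n} (h : HasFueterExpansion f a) : IsMonogenic f := by
  have hV : ∀ m : Fin n → ℕ, (fun x => fueterPoly m x * a m) ∈ waves n (∑ i, m i) :=
    fun m => fueterPoly_mul_mem_waves rfl _
  -- Differentiation costs at most a factor `q ≤ 2^q`, so the derivatives are dominated on the ball
  -- of radius `R` by the coefficient series at radius `2(1 + R)`.
  have hsum : ∀ R : ℝ, 0 ≤ R → Summable fun m : Fin n → ℕ =>
      (2 * (1 + R)) ^ (∑ i, m i) * ‖a m‖ := fun R hR =>
    h.summable_pow_mul_norm (by positivity)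
  have hbound : ∀ R : ℝ, ∀ (m : Fin n → ℕ), ∀ x ∈ Metric.ball (0 : EuclideanSpace ℝ (Fin (n + 1))) R,
      ‖fderiv ℝ (fun x => fueterPoly m x * a m) x‖ ≤ (2 * (1 + R)) ^ (∑ i, m i) * ‖a m‖ := by
    intro R m x hx
    refine (norm_fderiv_fueterPoly_mul_le rfl (a m) x).trans ?_
    have : ‖x‖ ≤ R := (mem_ball_zero_iff.1 hx).le
    gcongr
  have hf : f = fun x => ∑' m, fueterPoly m x * a m := funext fun x => (h x).tsum_eq.symm
  have hder : ∀ x, HasFDerivAt f (∑' m, fderiv ℝ (fun x => fueterPoly m x * a m) x) x := by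
    intro x
    rw [hf]
    have hx : x ∈ Metric.ball (0 : EuclideanSpace ℝ (Fin (n + 1))) (‖x‖ + 1) := by simp
    exact hasFDerivAt_tsum_of_isPreconnected (hsum (‖x‖ + 1) (by positivity)) Metric.isOpen_ball
      (convex_ball _ _).isPreconnected
      (fun m y _ => (differentiable_of_mem_waves (hV m) y).hasFDerivAt)
      (hbound (‖x‖ + 1)) hx (h x).summable hx
  have hfd : fderiv ℝ f = fun x => ∑' m, fderiv ℝ (fun x => fueterPoly m x * a m) x :=
    funext fun x => (hder x).fderiv
  refine ⟨contDiff_one_iff_fderiv.2 ⟨fun x => (hder x).differentiableAt, ?_⟩, fun x => ?_⟩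
  · rw [hfd, continuous_iff_continuousAt]
    intro x
    have hx : x ∈ Metric.ball (0 : EuclideanSpace ℝ (Fin (n + 1))) (‖x‖ + 1) := by simp
    refine (continuousOn_tsum (fun m => ?_) (hsum (‖x‖ + 1) (by positivity))
      (hbound (‖x‖ + 1))).continuousAt (Metric.isOpen_ball.mem_nhds hx)
    exact ((contDiff_of_mem_waves (k := 1) (hV m)).continuous_fderiv one_ne_zero).continuousOn
  · have hs : HasSum (fun m => fderiv ℝ (fun x => fueterPoly m x * a m) x) (fderiv ℝ f x) := by
      rw [hfd]
      refine Summable.hasSum (Summable.of_norm_bounded (hsum (‖x‖ + 1) (by positivity)) fun m => ?_)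
      exact hbound (‖x‖ + 1) m x (by simp)
    have hp : ∀ j, HasSum (fun m => partialDeriv j (fun x => fueterPoly m x * a m) x)
        (partialDeriv j f x) := fun j =>
      hs.mapL (ContinuousLinearMap.apply ℝ (Cl n) (EuclideanSpace.single j (1 : ℝ)))
    have hd := (hp 0).add (hasSum_sum (s := Finset.univ)
      fun (i : Fin n) _ => (hp i.succ).mapL (Cl.mulL n (Cl.unit i)))
    simp only [Cl.mulL_apply, dirac_of_mem_waves (hV _)] at hd
    exact hd.unique hasSum_zero

/-- The series is a product of `n` geometric series, one per coordinate. -/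
theorem summable_pow_sum {c : ℝ} (h0 : 0 ≤ c) (h1 : c < 1) :
    Summable fun m : Fin n → ℕ => c ^ ∑ i, m i := by
  induction n with
  | zero => exact (hasSum_fintype _).summable
  | succ n ih =>
    refine (Fin.consEquiv fun _ => ℕ).summable_iff.1 ?_
    refine ((summable_geometric_of_lt_one h0 h1).mul_of_nonneg ih (fun _ => by positivity)
      fun _ => by positivity).congr fun z => ?_
    simp [Fin.consEquiv, Fin.sum_univ_succ, pow_add]

/-! ### Proximate orders -/

variable {p : ℝ → ℝ} {ρ : ℝ}

/-- In the variable `s = ln r`, the derivative of `ln(r^{p(r)}) - ρ s` is `p(r) + p'(r) r ln r - ρ`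
(with `p'` the derivative of `p`), which tends to `0`; the mean value inequality gives the bound. -/
theorem IsProximateOrder.abs_log_sub_le (hp : IsProximateOrder p ρ) {η : ℝ} (hη : 0 < η) :
    ∃ R : ℝ, 0 < R ∧ ∀ r₁ r₂, R ≤ r₁ → R ≤ r₂ →
      |Real.log (r₂ ^ p r₂) - Real.log (r₁ ^ p r₁) - ρ * (Real.log r₂ - Real.log r₁)| ≤
        η * |Real.log r₂ - Real.log r₁| := by
  have hlim : Tendsto (fun s => p (Real.exp s) + deriv p (Real.exp s) * Real.exp s * s) atTop
      (𝓝 ρ) := by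
    have h1 := (hp.tendsto.add hp.tendsto_deriv).comp Real.tendsto_exp_atTop
    simpa [Function.comp_def] using h1
  obtain ⟨s₀, hs₀⟩ := (Metric.tendsto_atTop.1 hlim) η hη
  refine ⟨Real.exp s₀, Real.exp_pos _, fun r₁ r₂ h1 h2 => ?_⟩
  have hr1 : 0 < r₁ := (Real.exp_pos _).trans_le h1
  have hr2 : 0 < r₂ := (Real.exp_pos _).trans_le h2
  have hder : ∀ s ∈ Set.Ici s₀, HasDerivWithinAt (fun s => s * p (Real.exp s) - ρ * s)
      (p (Real.exp s) + deriv p (Real.exp s) * Real.exp s * s - ρ) (Set.Ici s₀) s := by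
    intro s _
    have hd : HasDerivAt p (deriv p (Real.exp s)) (Real.exp s) :=
      (hp.differentiableOn.differentiableAt (Ici_mem_nhds (Real.exp_pos s))).hasDerivAt
    have := ((hasDerivAt_id s).mul (hd.comp s (Real.hasDerivAt_exp s))).sub
      ((hasDerivAt_id s).const_mul ρ)
    refine (this.congr_deriv ?_).hasDerivWithinAt
    simp
    ring
  have := (convex_Ici s₀).norm_image_sub_le_of_norm_hasDerivWithin_le (C := η) hder
    (fun s hs => (hs₀ s hs).le) ((Real.le_log_iff_exp_le hr1).2 h1)
    ((Real.le_log_iff_exp_le hr2).2 h2)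
  rw [Real.exp_log hr1, Real.exp_log hr2, Real.norm_eq_abs, Real.norm_eq_abs] at this
  rw [Real.log_rpow hr1, Real.log_rpow hr2]
  refine le_trans (le_of_eq ?_) this
  congr 1
  ring

namespace IsNormalization

variable {p' : ℝ → ℝ}

theorem phi_pos (h : IsNormalization p p' ρ) {t : ℝ} (ht : 0 < t) : 0 < phi p' t :=
  Function.invFunOn_mem (s := Set.Ioi 0) (f := fun r : ℝ => r ^ p' r)
    (by have : t ∈ (fun r : ℝ => r ^ p' r) '' Set.Ioi 0 := by rw [h.image_eq]; exact ht
        exact this)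

theorem rpow_phi (h : IsNormalization p p' ρ) {t : ℝ} (ht : 0 < t) : phi p' t ^ p' (phi p' t) = t :=
  Function.invFunOn_eq (s := Set.Ioi 0) (f := fun r : ℝ => r ^ p' r)
    (by have : t ∈ (fun r : ℝ => r ^ p' r) '' Set.Ioi 0 := by rw [h.image_eq]; exact ht
        exact this)

theorem phi_rpow (h : IsNormalization p p' ρ) {r : ℝ} (hr : 0 < r) : phi p' (r ^ p' r) = r :=
  h.strictMonoOn.injOn (h.phi_pos (Real.rpow_pos_of_pos hr _)) hr
    (h.rpow_phi (Real.rpow_pos_of_pos hr _))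

theorem le_phi (h : IsNormalization p p' ρ) {R t : ℝ} (hR : 0 < R) (ht : R ^ p' R ≤ t) : R ≤ phi p' t := by
  have ht0 : 0 < t := (Real.rpow_pos_of_pos hR _).trans_le ht
  rw [← h.rpow_phi ht0] at ht
  exact (h.strictMonoOn.le_iff_le hR (h.phi_pos ht0)).1 ht

theorem abs_log_phi_sub_le (h : IsNormalization p p' ρ) (hρ : 0 < ρ) {η : ℝ} (hη : 0 < η) :
    ∃ T : ℝ, 0 < T ∧ ∀ t₁ t₂, T ≤ t₁ → T ≤ t₂ →
      |Real.log (phi p' t₂) - Real.log (phi p' t₁) - (Real.log t₂ - Real.log t₁) / ρ| ≤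
        η * |Real.log t₂ - Real.log t₁| := by
  -- The bound `ρ / 2` first yields `ρ|y| ≤ 2|x|`; then `η ρ² / 2` turns an error measured in `y = Δ
  -- ln φ` into one measured in `x = Δ ln t`.
  obtain ⟨R, hR, hR'⟩ := h.isProximateOrder.abs_log_sub_le (η := min (ρ / 2) (η * ρ ^ 2 / 2))
    (by positivity)
  refine ⟨R ^ p' R, Real.rpow_pos_of_pos hR _, fun t₁ t₂ h1 h2 => ?_⟩
  have ht1 : 0 < t₁ := (Real.rpow_pos_of_pos hR _).trans_le h1
  have ht2 : 0 < t₂ := (Real.rpow_pos_of_pos hR _).trans_le h2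
  have key := hR' _ _ (h.le_phi hR h1) (h.le_phi hR h2)
  rw [h.rpow_phi ht1, h.rpow_phi ht2] at key
  set x := Real.log t₂ - Real.log t₁
  set y := Real.log (phi p' t₂) - Real.log (phi p' t₁)
  have k1 : |x - ρ * y| ≤ ρ / 2 * |y| := key.trans (by gcongr; exact min_le_left _ _)
  have k2 : |x - ρ * y| ≤ η * ρ ^ 2 / 2 * |y| := key.trans (by gcongr; exact min_le_right _ _)
  have k3 : ρ * |y| ≤ |x| + |x - ρ * y| := by
    have := abs_sub_abs_le_abs_sub (ρ * y) x
    rw [abs_mul, abs_of_pos hρ, abs_sub_comm (ρ * y) x] at this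
    linarith
  have k4 : ρ * |y| ≤ 2 * |x| := by linarith
  have k5 : y - x / ρ = -(x - ρ * y) / ρ := by field_simp; ring
  rw [k5, abs_div, abs_neg, abs_of_pos hρ, div_le_iff₀ hρ]
  calc _ ≤ η * ρ ^ 2 / 2 * |y| := k2
    _ = η * ρ / 2 * (ρ * |y|) := by ring
    _ ≤ η * ρ / 2 * (2 * |x|) := by gcongr
    _ = _ := by ring

end IsNormalization

end

section

open Filter Topology

variable {n : ℕ} {p p' : ℝ → ℝ} {ρ : ℝ}

/-! ### From growth to coefficients -/

theorem norm_le_maxNorm {q : ℕ} {m : Fin n → ℕ} (hm : ∑ i, m i = q) (a : (Fin n → ℕ) → Cl n) :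
    ‖a m‖ ≤ maxNorm a q := by
  have : ‖a m‖₊ ≤ maxNorm a q :=
    Finset.le_sup (f := fun m => ‖a m‖₊) (mem_piAntidiag_of_sum_eq hm)
  exact_mod_cast this

theorem maxNorm_le {q : ℕ} {a : (Fin n → ℕ) → Cl n} {B : ℝ} (hB : 0 ≤ B)
    (h : ∀ m, ∑ i, m i = q → ‖a m‖ ≤ B) : (maxNorm a q : ℝ) ≤ B := by
  lift B to ℝ≥0 using hB
  refine NNReal.coe_le_coe.2 (Finset.sup_le fun m hm => ?_)
  exact_mod_cast h m (sum_eq_of_mem_piAntidiag hm)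

theorem IsNormalization.G_pos (h : IsNormalization p p' ρ) (hρ : 0 < ρ) {q : ℕ} (hq : 0 < q) :
    0 < G p' ρ q := by
  have := h.phi_pos (t := q) (by exact_mod_cast hq)
  unfold G
  positivity

theorem IsNormalization.G_eq_exp (h : IsNormalization p p' ρ) (hρ : 0 < ρ) {q : ℕ} (hq : 0 < q) :
    G p' ρ q = Real.exp (q * Real.log (phi p' q) - q / ρ * (1 + Real.log ρ)) := by
  have hφ := h.phi_pos (t := q) (by exact_mod_cast hq)
  rw [G, Real.exp_sub, mul_comm (q : ℝ) (Real.log _), Real.exp_mul, Real.exp_log hφ,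
    Real.rpow_natCast, Real.rpow_def_of_pos (by positivity), Real.log_mul (Real.exp_ne_zero _) hρ.ne',
    Real.log_exp]
  congr 2
  ring

/-- The exponent bounding `max ‖a_m‖ G_q` for a function of growth `C exp(σ r^{p(r)})`. -/
def coeffExponent (n : ℕ) (p' : ℝ → ℝ) (ρ σ C : ℝ) (q : ℕ) : ℝ :=
  Real.log C + n * Real.log (n + q) + q * Real.log n + q / ρ -
    q * Real.log (phi p' (1 / (ρ * σ) * q)) + q * Real.log (phi p' q) - q / ρ * (1 + Real.log ρ)

theorem tendsto_coeffExponent (h : IsNormalization p p' ρ) (hρ : 0 < ρ) {σ : ℝ} (hσ : 0 < σ)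
    (n : ℕ) (C : ℝ) :
    Tendsto (fun q : ℕ => coeffExponent n p' ρ σ C q * (ρ / q)) atTop
      (𝓝 (ρ * Real.log n + Real.log σ)) := by
  set lam := 1 / (ρ * σ) with hlam
  have hlam0 : 0 < lam := by positivity
  have h1 : Tendsto (fun q : ℕ => Real.log C / (q : ℝ)) atTop (𝓝 0) :=
    tendsto_const_div_atTop_nhds_zero_nat _
  have h2 : Tendsto (fun q : ℕ => Real.log ((n : ℝ) + q) / (q : ℝ)) atTop (𝓝 0) := by
    have hs : Tendsto (fun q : ℕ => (n : ℝ) + q) atTop atTop :=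
      tendsto_atTop_add_const_left _ _ tendsto_natCast_atTop_atTop
    have ha := (Real.isLittleO_log_id_atTop.tendsto_div_nhds_zero).comp hs
    have hb : Tendsto (fun q : ℕ => ((n : ℝ) + q) / q) atTop (𝓝 1) := by
      have := (tendsto_const_div_atTop_nhds_zero_nat (n : ℝ)).add_const 1
      rw [zero_add] at this
      refine this.congr' ?_
      filter_upwards [eventually_gt_atTop 0] with q hq
      have : (q : ℝ) ≠ 0 := by exact_mod_cast hq.ne'
      field_simp
    have := ha.mul hb
    rw [zero_mul] at this
    refine this.congr' ?_
    filter_upwards [eventually_gt_atTop 0] with q hq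
    have h3 : (q : ℝ) ≠ 0 := by exact_mod_cast hq.ne'
    have h4 : (n : ℝ) + q ≠ 0 := by positivity
    simp only [Function.comp, id]
    field_simp
  -- Under a fixed scaling, `φ` behaves like the power `t^{1/ρ}`. This limit produces `ln σ`; the
  -- terms with `C` and `n + q` vanish after division by `q`.
  have h3 : Tendsto (fun q : ℕ => Real.log (phi p' q) - Real.log (phi p' (lam * q))) atTop
      (𝓝 (-Real.log lam / ρ)) := by
    rw [Metric.tendsto_atTop]
    intro ε hε
    obtain ⟨T, hT, hT'⟩ := h.abs_log_phi_sub_le hρ (η := ε / (2 * (|Real.log lam| + 1)))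
      (by positivity)
    obtain ⟨N, hN⟩ := exists_nat_ge (max T (T / lam))
    refine ⟨N, fun q hq => ?_⟩
    have hq1 : max T (T / lam) ≤ q := hN.trans (by exact_mod_cast hq)
    have hq2 : T ≤ q := (le_max_left _ _).trans hq1
    have hq3 : T ≤ lam * q := by
      have := (le_max_right _ _).trans hq1
      rwa [div_le_iff₀' hlam0] at this
    have hq0 : (0 : ℝ) < q := hT.trans_le hq2
    have := hT' _ _ hq3 hq2
    rw [Real.log_mul hlam0.ne' hq0.ne', sub_add_cancel_right, abs_neg] at this
    rw [Real.dist_eq]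
    refine this.trans_lt ?_
    rw [div_mul_eq_mul_div, div_lt_iff₀ (by positivity)]
    nlinarith [abs_nonneg (Real.log lam)]
  have h4 := (((h1.const_mul ρ).add (h2.const_mul (ρ * n))).add (h3.const_mul ρ)).add_const
    (ρ * Real.log n - Real.log ρ)
  have h5 : ρ * 0 + ρ * n * 0 + ρ * (-Real.log lam / ρ) + (ρ * Real.log n - Real.log ρ) =
      ρ * Real.log n + Real.log σ := by
    rw [hlam, Real.log_div one_ne_zero (by positivity), Real.log_one,
      Real.log_mul hρ.ne' hσ.ne']
    field_simp
    ring
  rw [h5] at h4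
  refine h4.congr' ?_
  filter_upwards [eventually_gt_atTop 0] with q hq
  have hq0 : (q : ℝ) ≠ 0 := by exact_mod_cast hq.ne'
  rw [coeffExponent, ← hlam]
  generalize Real.log (phi p' (lam * q)) = L
  field_simp
  ring

theorem maxNorm_mul_G_le (h : IsNormalization p p' ρ) (hρ : 0 < ρ) (hn : 1 ≤ n) {σ : ℝ}
    (hσ : 0 < σ) {f : EuclideanSpace ℝ (Fin (n + 1)) → Cl n} {a : (Fin n → ℕ) → Cl n}
    (hfa : HasFueterExpansion f a) (hf : f ∈ ASpace n p σ) :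
    ∃ C : ℝ, ∀ᶠ q : ℕ in atTop,
      (maxNorm a q : ℝ) * G p' ρ q ≤ Real.exp (coeffExponent n p' ρ σ C q) := by
  obtain ⟨hmono, C₀, hC₀⟩ := hf
  obtain ⟨r₁, hr₁, hpp⟩ := h.eventually_eq
  set C := max C₀ 1 with hCdef
  have hC : 0 < C := lt_max_of_lt_right one_pos
  have hfb : ∀ x, ‖f x‖ ≤ C * Real.exp (σ * ‖x‖ ^ p ‖x‖) := by
    intro x
    have h1 : ‖f x‖ * Real.exp (-σ * ‖x‖ ^ p ‖x‖) ≤ C := (hC₀ ⟨x, rfl⟩).trans (le_max_left _ _)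
    rwa [neg_mul, Real.exp_neg, ← div_eq_mul_inv, div_le_iff₀ (Real.exp_pos _)] at h1
  have hlam : 0 < 1 / (ρ * σ) := by positivity
  refine ⟨C, ?_⟩
  have hlarge : ∀ᶠ q : ℕ in atTop, r₁ ^ p' r₁ ≤ 1 / (ρ * σ) * q :=
    (tendsto_natCast_atTop_atTop.const_mul_atTop hlam).eventually_ge_atTop _
  filter_upwards [hlarge, eventually_gt_atTop 0] with q hq hq0
  have hqR : (0 : ℝ) < q := by exact_mod_cast hq0
  -- For a constant order, `r^ρ = q/(ρσ)` minimizes `exp(σ r^ρ) / r^q`. With `r = φ(t)` the growth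
  -- factor is exactly `exp(q/ρ)`.
  set t := 1 / (ρ * σ) * q with ht
  have ht0 : 0 < t := by positivity
  set r := phi p' t with hr
  have hr0 : 0 < r := h.phi_pos ht0
  have hrr : r₁ ≤ r := h.le_phi hr₁ hq
  have hM : ∀ x : EuclideanSpace ℝ (Fin (n + 1)), ‖x‖ = r → ‖f x‖ ≤ C * Real.exp (q / ρ) := by
    intro x hx
    refine (hfb x).trans (le_of_eq ?_)
    rw [hx, ← hpp r hrr, h.rpow_phi ht0, ht]
    congr 2
    field_simp
  have hn0 : (0 : ℝ) < n := by exact_mod_cast hn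
  have hB : (maxNorm a q : ℝ) ≤ ((n : ℝ) + q) ^ n * (n : ℝ) ^ q * (C * Real.exp (q / ρ)) / r ^ q := by
    refine maxNorm_le (by positivity) fun m hm => ?_
    rw [le_div_iff₀ (by positivity)]
    exact hfa.norm_mul_pow_le hn hmono.1.continuous hm hr0.le (by positivity) hM
  have hpow : ∀ (z : ℝ) (k : ℕ), 0 < z → Real.exp (k * Real.log z) = z ^ k := by
    intro z k hz
    rw [mul_comm, Real.exp_mul, Real.exp_log hz, Real.rpow_natCast]
  have hE : coeffExponent n p' ρ σ C q = (n * Real.log (n + q) + q * Real.log n +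
      (Real.log C + q / ρ) - q * Real.log r) +
      (q * Real.log (phi p' q) - q / ρ * (1 + Real.log ρ)) := by
    rw [coeffExponent]
    ring
  rw [hE, Real.exp_add _ (_ - _), ← h.G_eq_exp hρ hq0, Real.exp_sub, Real.exp_add, Real.exp_add,
    Real.exp_add, hpow _ _ hr0, hpow _ _ hn0, hpow _ _ (by positivity), Real.exp_log hC]
  exact mul_le_mul_of_nonneg_right hB (h.G_pos hρ hq0).le

theorem coeffLimsup_le_of_mem_ASpace (h : IsNormalization p p' ρ) (hρ : 0 < ρ) (hn : 1 ≤ n)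
    {σ : ℝ} (hσ : 0 < σ) {f : EuclideanSpace ℝ (Fin (n + 1)) → Cl n} {a : (Fin n → ℕ) → Cl n}
    (hfa : HasFueterExpansion f a) (hf : f ∈ ASpace n p σ) :
    coeffLimsup p' ρ a ≤ ENNReal.ofReal ((n : ℝ) ^ ρ * σ) := by
  obtain ⟨C, hC⟩ := maxNorm_mul_G_le h hρ hn hσ hfa hf
  have hn0 : (0 : ℝ) < n := by exact_mod_cast hn
  have hlim := (Real.continuous_exp.tendsto _).comp (tendsto_coeffExponent h hρ hσ n C)
  rw [Real.exp_add, Real.exp_log hσ, mul_comm ρ, Real.exp_mul, Real.exp_log hn0] at hlim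
  have hlim' := ENNReal.tendsto_ofReal hlim
  rw [← hlim'.limsup_eq]
  refine limsup_le_limsup ?_
  filter_upwards [hC, eventually_gt_atTop 0] with q hq hq0
  refine ENNReal.ofReal_le_ofReal ?_
  rw [Function.comp, Real.exp_mul]
  have := h.G_pos hρ hq0
  gcongr

theorem coeffLimsup_le_of_mem_ASpaceInter (h : IsNormalization p p' ρ) (hρ : 0 < ρ) (hn : 1 ≤ n)
    {σ : ℝ} (hσ : 0 ≤ σ) {f : EuclideanSpace ℝ (Fin (n + 1)) → Cl n} {a : (Fin n → ℕ) → Cl n}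
    (hfa : HasFueterExpansion f a) (hf : f ∈ ASpaceInter n p σ) :
    coeffLimsup p' ρ a ≤ ENNReal.ofReal ((n : ℝ) ^ ρ * σ) := by
  have hlim : Tendsto (fun ε : ℝ => ENNReal.ofReal ((n : ℝ) ^ ρ * (σ + ε))) (𝓝[>] 0)
      (𝓝 (ENNReal.ofReal ((n : ℝ) ^ ρ * σ))) := by
    refine ENNReal.tendsto_ofReal (tendsto_nhdsWithin_of_tendsto_nhds ?_)
    have : Continuous fun ε : ℝ => (n : ℝ) ^ ρ * (σ + ε) := by fun_prop
    simpa using this.tendsto 0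
  refine ge_of_tendsto hlim ?_
  filter_upwards [self_mem_nhdsWithin] with ε hε
  have hε0 : 0 < ε := hε
  exact coeffLimsup_le_of_mem_ASpace h hρ hn (by positivity) hfa
    (Set.mem_iInter₂.1 hf ε hε0)

/-! ### From coefficients to growth -/

/-- The right side is the tangent form of convexity: apply `ln x ≤ x - 1` to `x = (B/s) e^u`. -/
theorem mul_le_mul_exp_sub {s B : ℝ} (hs : 0 < s) (hB : 0 < B) (u : ℝ) :
    s * u ≤ B * Real.exp u - s - s * Real.log (B / s) := by
  have h1 := Real.log_le_sub_one_of_pos (x := B / s * Real.exp u) (by positivity)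
  rw [Real.log_mul (by positivity) (Real.exp_ne_zero _), Real.log_exp] at h1
  have h2 := mul_le_mul_of_nonneg_left h1 hs.le
  have h3 : s * (B / s * Real.exp u - 1) = B * Real.exp u - s := by field_simp
  linarith

/-- With `u = ln(t/q)`, the increment of `ln φ` is at most `s u` for some `s` near `1/ρ`, and
`mul_le_mul_exp_sub` bounds `s u` by `B t/q` plus a constant. At `s = 1/ρ` the total constant is
`(ln A - ln B)/ρ < 0`; by continuity half of this deficit survives for nearby `s` and serves as `δ`.
-/
theorem IsNormalization.exists_log_le (h : IsNormalization p p' ρ) (hρ : 0 < ρ) {A B : ℝ}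
    (hA : 0 < A) (hAB : A < B) :
    ∃ δ T : ℝ, 0 < δ ∧ 0 < T ∧ ∀ q t : ℝ, T ≤ q → T ≤ t →
      q * (Real.log (phi p' t) - Real.log (phi p' q) + (Real.log A + 1 + Real.log ρ) / ρ) ≤
        B * t - δ * q := by
  have hB : 0 < B := hA.trans hAB
  set g : ℝ → ℝ := fun s => -s - s * Real.log (B / s) + (Real.log A + 1 + Real.log ρ) / ρ with hg
  have hg1 : g (1 / ρ) = (Real.log A - Real.log B) / ρ := by
    simp only [hg, div_div_eq_mul_div, div_one]
    rw [Real.log_mul hB.ne' hρ.ne']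
    ring
  have hneg : g (1 / ρ) < 0 := by
    rw [hg1]
    exact div_neg_of_neg_of_pos (sub_neg.2 (Real.log_lt_log hA hAB)) hρ
  have hcont : ContinuousAt g (1 / ρ) := by
    have h0 : 1 / ρ ≠ 0 := by positivity
    have h1 : B / (1 / ρ) ≠ 0 := by positivity
    fun_prop (disch := assumption)
  obtain ⟨η₀, hη₀, hη⟩ := Metric.eventually_nhds_iff.1
    (hcont.eventually_lt_const (show g (1 / ρ) < g (1 / ρ) / 2 by linarith))
  set η := min (η₀ / 2) (1 / (2 * ρ)) with hηdef
  have hηpos : 0 < η := by positivity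
  have hη1 : η < η₀ := (min_le_left _ _).trans_lt (by linarith)
  have hη2 : η < 1 / ρ := (min_le_right _ _).trans_lt (by
    rw [div_lt_div_iff₀ (by positivity) hρ]; linarith)
  obtain ⟨T, hT, hT'⟩ := h.abs_log_phi_sub_le hρ hηpos
  refine ⟨-(g (1 / ρ) / 2), T, by linarith, hT, fun q t hq ht => ?_⟩
  have hq0 : 0 < q := hT.trans_le hq
  have ht0 : 0 < t := hT.trans_le ht
  have key := hT' q t hq ht
  set u := Real.log t - Real.log q with hu
  have hexp : Real.exp u = t / q := by rw [hu, Real.exp_sub, Real.exp_log ht0, Real.exp_log hq0]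
  -- The error `η|u|` is absorbed into the slope: `1/ρ + η` or `1/ρ - η` according to the sign of
  -- `u`.
  obtain ⟨s, hs0, hsη, hsu⟩ : ∃ s : ℝ, 0 < s ∧ dist s (1 / ρ) < η₀ ∧
      u / ρ + η * |u| = s * u := by
    rcases le_total 0 u with hu0 | hu0
    · refine ⟨1 / ρ + η, by positivity, ?_, ?_⟩
      · rw [Real.dist_eq, add_sub_cancel_left, abs_of_pos hηpos]; exact hη1
      · rw [abs_of_nonneg hu0]; ring
    · refine ⟨1 / ρ - η, by linarith, ?_, ?_⟩
      · rw [Real.dist_eq, sub_sub_cancel_left, abs_neg, abs_of_pos hηpos]; exact hη1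
      · rw [abs_of_nonpos hu0]; ring
  have h1 : Real.log (phi p' t) - Real.log (phi p' q) ≤ s * u := by
    rw [← hsu]
    linarith [le_abs_self (Real.log (phi p' t) - Real.log (phi p' q) - u / ρ)]
  have h2 := mul_le_mul_exp_sub hs0 hB u
  have h3 : g s < g (1 / ρ) / 2 := hη hsη
  rw [hexp] at h2
  have h4 : Real.log (phi p' t) - Real.log (phi p' q) + (Real.log A + 1 + Real.log ρ) / ρ ≤
      B * (t / q) + g (1 / ρ) / 2 := by
    simp only [hg] at h3 ⊢
    linarith
  refine (mul_le_mul_of_nonneg_left h4 hq0.le).trans (le_of_eq ?_)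
  field_simp
  ring

theorem IsNormalization.exists_pow_le (h : IsNormalization p p' ρ) (hρ : 0 < ρ) {A B : ℝ}
    (hA : 0 < A) (hAB : A < B) :
    ∃ δ R : ℝ, ∃ Q : ℕ, 0 < δ ∧ 0 < R ∧ 0 < Q ∧ ∀ q : ℕ, Q ≤ q → ∀ r : ℝ, R ≤ r →
      A ^ ((q : ℝ) / ρ) * r ^ q ≤ G p' ρ q * Real.exp (B * r ^ p' r - δ * q) := by
  obtain ⟨δ, T, hδ, hT, hle⟩ := h.exists_log_le hρ hA hAB
  obtain ⟨Q, hQ⟩ := exists_nat_ge T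
  have hQ0 : 0 < Q := by exact_mod_cast hT.trans_le hQ
  refine ⟨δ, phi p' T, Q, hδ, h.phi_pos hT, hQ0, fun q hq r hr => ?_⟩
  have hr0 : 0 < r := (h.phi_pos hT).trans_le hr
  have hq0 : 0 < q := hQ0.trans_le hq
  have ht : T ≤ r ^ p' r := by
    have := (h.strictMonoOn.le_iff_le (h.phi_pos hT) hr0).2 hr
    rwa [h.rpow_phi hT] at this
  have key := hle q (r ^ p' r) (hQ.trans (by exact_mod_cast hq)) ht
  rw [h.phi_rpow hr0] at key
  have h1 : r ^ q = Real.exp (q * Real.log r) := by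
    rw [mul_comm, Real.exp_mul, Real.exp_log hr0, Real.rpow_natCast]
  rw [h.G_eq_exp hρ hq0, Real.rpow_def_of_pos hA, h1, ← Real.exp_add, ← Real.exp_add,
    Real.exp_le_exp]
  have h2 : (q : ℝ) * ((Real.log A + 1 + Real.log ρ) / ρ) =
      Real.log A * (q / ρ) + q / ρ * (1 + Real.log ρ) := by field_simp; ring
  linarith

theorem IsNormalization.exists_maxNorm_mul_pow_le (h : IsNormalization p p' ρ) (hρ : 0 < ρ)
    {A B : ℝ} (hA : 0 ≤ A) (hAB : A < B) {a : (Fin n → ℕ) → Cl n}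
    (ha : coeffLimsup p' ρ a ≤ ENNReal.ofReal A) :
    ∃ δ R C : ℝ, 0 < δ ∧ 0 < R ∧ 0 ≤ C ∧ ∀ (q : ℕ) (r : ℝ), R ≤ r →
      (maxNorm a q : ℝ) * r ^ q ≤ C * Real.exp (B * r ^ p' r) * Real.exp (-δ) ^ q := by
  -- The gap is used twice: `A < A'` makes the limsup bound hold for all large `q`, and `A' < B`
  -- produces the decay `δ`. It also makes `A'` positive when `A = 0`.
  obtain ⟨A', hAA', hA'B⟩ := exists_between hAB
  have hA' : 0 < A' := hA.trans_lt hAA'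
  obtain ⟨δ, R, Q₁, hδ, hR, hQ₁, hle⟩ := h.exists_pow_le hρ hA' hA'B
  have hev : ∀ᶠ q : ℕ in atTop, (maxNorm a q : ℝ) * G p' ρ q ≤ A' ^ ((q : ℝ) / ρ) := by
    have h1 : coeffLimsup p' ρ a < ENNReal.ofReal A' :=
      ha.trans_lt ((ENNReal.ofReal_lt_ofReal_iff hA').2 hAA')
    filter_upwards [eventually_lt_of_limsup_lt h1, eventually_gt_atTop 0] with q hq hq0
    have h2 := (ENNReal.ofReal_lt_ofReal_iff hA').1 hq
    have hG := h.G_pos hρ hq0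
    have hqR : (0 : ℝ) < q := by exact_mod_cast hq0
    have h3 := Real.rpow_le_rpow (z := q / ρ) (by positivity) h2.le (by positivity)
    rwa [← Real.rpow_mul (by positivity), div_mul_div_cancel₀ hqR.ne', div_self hρ.ne',
      Real.rpow_one] at h3
  obtain ⟨Q₂, hQ₂⟩ := eventually_atTop.1 hev
  set Q := max Q₁ Q₂ with hQ
  have hQ0 : 0 < Q := hQ₁.trans_le (le_max_left _ _)
  have hGQ := h.G_pos hρ hQ0
  have hexpq : ∀ q : ℕ, Real.exp (-δ) ^ q = Real.exp (-(δ * q)) := by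
    intro q
    rw [← Real.exp_nat_mul]
    congr 1
    ring
  set K := G p' ρ Q / A' ^ ((Q : ℝ) / ρ) with hK
  have hK0 : 0 < K := by positivity
  set S : ℝ := ∑ q ∈ Finset.range Q, (maxNorm a q : ℝ) with hS
  have hS0 : 0 ≤ S := Finset.sum_nonneg fun q _ => NNReal.coe_nonneg _
  refine ⟨δ, max R 1, 1 + S * K, hδ, lt_max_of_lt_left hR, by positivity, fun q r hr => ?_⟩
  have hrR : R ≤ r := (le_max_left _ _).trans hr
  have hr1 : 1 ≤ r := (le_max_right _ _).trans hr
  rw [hexpq, mul_assoc, ← Real.exp_add, ← sub_eq_add_neg]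
  rcases le_or_gt Q q with hq | hq
  · have hq0 : 0 < q := hQ0.trans_le hq
    have hG := h.G_pos hρ hq0
    have h1 := hQ₂ q ((le_max_right _ _).trans hq)
    have h2 := hle q ((le_max_left _ _).trans hq) r hrR
    have h3 : (maxNorm a q : ℝ) * r ^ q ≤ Real.exp (B * r ^ p' r - δ * q) := by
      refine le_of_mul_le_mul_left ?_ hG
      calc G p' ρ q * ((maxNorm a q : ℝ) * r ^ q) = (maxNorm a q * G p' ρ q) * r ^ q := by ring
        _ ≤ A' ^ ((q : ℝ) / ρ) * r ^ q := by gcongr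
        _ ≤ _ := h2
    refine h3.trans (le_mul_of_one_le_left (Real.exp_pos _).le ?_)
    linarith [mul_nonneg hS0 hK0.le]
  -- The finitely many low degrees are dominated by degree `Q`, since `r ≥ 1`; the constant `S * K`
  -- pays for them.
  · have h2 := hle Q (le_max_left _ _) r hrR
    have h3 : r ^ Q ≤ K * Real.exp (B * r ^ p' r - δ * Q) := by
      rw [hK, div_mul_eq_mul_div, le_div_iff₀ (by positivity), mul_comm]
      exact h2
    have h4 : (maxNorm a q : ℝ) ≤ S :=
      Finset.single_le_sum (f := fun q => (maxNorm a q : ℝ)) (fun q _ => NNReal.coe_nonneg _)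
        (Finset.mem_range.2 hq)
    have h5 : (q : ℝ) ≤ Q := by exact_mod_cast hq.le
    calc (maxNorm a q : ℝ) * r ^ q ≤ S * r ^ Q := by
          gcongr
      _ ≤ S * (K * Real.exp (B * r ^ p' r - δ * q)) := by
          gcongr
          exact h3.trans (by gcongr)
      _ ≤ _ := by
          rw [← mul_assoc]
          gcongr
          linarith

theorem exists_norm_fueterPoly_mul_le (h : IsNormalization p p' ρ) (hρ : 0 < ρ)
    {A B : ℝ} (hA : 0 ≤ A) (hAB : A < B) {a : (Fin n → ℕ) → Cl n}
    (ha : coeffLimsup p' ρ a ≤ ENNReal.ofReal A) :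
    ∃ c R C : ℝ, 0 ≤ c ∧ c < 1 ∧ 0 < R ∧ 0 ≤ C ∧ ∀ (m : Fin n → ℕ) x (r : ℝ), R ≤ r → ‖x‖ ≤ r →
      ‖fueterPoly m x * a m‖ ≤ C * Real.exp (B * r ^ p' r) * c ^ ∑ i, m i := by
  obtain ⟨δ, R, C, hδ, hR, hC, hle⟩ := h.exists_maxNorm_mul_pow_le hρ hA hAB ha
  refine ⟨Real.exp (-δ), R, C, (Real.exp_pos _).le, Real.exp_lt_one_iff.2 (by linarith), hR, hC,
    fun m x r hr hx => ?_⟩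
  refine le_trans ?_ (hle _ r hr)
  rw [mul_comm]
  refine (norm_fueterPoly_mul_le rfl x (a m)).trans ?_
  exact mul_le_mul (pow_le_pow_left₀ (norm_nonneg x) hx _) (norm_le_maxNorm rfl a) (norm_nonneg _)
    (pow_nonneg (hR.le.trans hr) _)

theorem summable_fueterPoly_mul (h : IsNormalization p p' ρ) (hρ : 0 < ρ)
    {A : ℝ} (hA : 0 ≤ A) {a : (Fin n → ℕ) → Cl n}
    (ha : coeffLimsup p' ρ a ≤ ENNReal.ofReal A) (x : EuclideanSpace ℝ (Fin (n + 1))) :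
    Summable fun m => fueterPoly m x * a m := by
  obtain ⟨c, R, C, hc0, hc1, hR, hC, hle⟩ := exists_norm_fueterPoly_mul_le h hρ hA
    (lt_add_one A) ha
  exact Summable.of_norm_bounded ((summable_pow_sum hc0 hc1).mul_left _)
    fun m => hle m x (max R ‖x‖) (le_max_left _ _) (le_max_right _ _)

theorem mem_ASpaceInter_of_coeffLimsup_le (h : IsNormalization p p' ρ) (hρ : 0 < ρ)
    {A : ℝ} (hA : 0 ≤ A) {a : (Fin n → ℕ) → Cl n}
    (ha : coeffLimsup p' ρ a ≤ ENNReal.ofReal A) {f : EuclideanSpace ℝ (Fin (n + 1)) → Cl n}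
    (hfa : HasFueterExpansion f a) : f ∈ ASpaceInter n p A := by
  refine Set.mem_iInter₂.2 fun ε hε => ⟨hfa.isMonogenic, ?_⟩
  obtain ⟨c, R, C, hc0, hc1, hR, hC, hle⟩ := exists_norm_fueterPoly_mul_le h hρ hA
    (lt_add_of_pos_right A hε) ha
  obtain ⟨r₁, hr₁, hpp⟩ := h.eventually_eq
  obtain ⟨D, hD⟩ := (isCompact_closedBall (0 : EuclideanSpace ℝ (Fin (n + 1)))
    (max R r₁)).exists_bound_of_continuousOn hfa.isMonogenic.1.continuous.continuousOn
  refine ⟨max D (C * ∑' m : Fin n → ℕ, c ^ ∑ i, m i), ?_⟩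
  rintro _ ⟨x, rfl⟩
  -- The series bound holds only for large radii, where also `p' = p`; on the remaining ball `f` is
  -- bounded by compactness.
  rcases le_total ‖x‖ (max R r₁) with hx | hx
  · refine le_max_of_le_left (le_trans ?_ (hD x (by simpa using hx)))
    refine mul_le_of_le_one_right (norm_nonneg _) (Real.exp_le_one_iff.2 ?_)
    have : 0 ≤ ‖x‖ ^ p ‖x‖ := Real.rpow_nonneg (norm_nonneg _) _
    nlinarith
  · refine le_max_of_le_right ?_
    have h1 : ‖f x‖ ≤ C * Real.exp ((A + ε) * ‖x‖ ^ p' ‖x‖) * ∑' m : Fin n → ℕ, c ^ ∑ i, m i := by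
      rw [← (hfa x).tsum_eq, ← tsum_mul_left]
      exact tsum_of_norm_bounded ((summable_pow_sum hc0 hc1).mul_left _).hasSum
        fun m => hle m x ‖x‖ ((le_max_left _ _).trans hx) le_rfl
    rw [hpp _ ((le_max_right _ _).trans hx)] at h1
    change ‖f x‖ * Real.exp (-(A + ε) * ‖x‖ ^ p ‖x‖) ≤ _
    rw [neg_mul, Real.exp_neg, ← div_eq_mul_inv, div_le_iff₀ (Real.exp_pos _)]
    refine h1.trans (le_of_eq ?_)
    ring

end

end Monogenic

end

/-! ### The three assertions assembled -/

theorem corollary3 (n : ℕ) (hn : 1 ≤ n) (ρ : ℝ) (hρ : 0 < ρ) (p p' : ℝ → ℝ)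
    (hp : Monogenic.IsProximateOrder p ρ) (hp' : Monogenic.IsNormalization p p' ρ) :
    -- growth of `f` bounds the coefficients
    (∀ σ : ℝ, 0 ≤ σ →
      ∀ (f : EuclideanSpace ℝ (Fin (n + 1)) → Monogenic.Cl n) (a : (Fin n → ℕ) → Monogenic.Cl n),
        Monogenic.HasFueterExpansion f a → f ∈ Monogenic.ASpaceInter n p σ →
          Monogenic.coeffLimsup p' ρ a ≤ ENNReal.ofReal ((n : ℝ) ^ ρ * σ)) ∧
    -- the coefficient bound implies convergence of the expansion and growth of its sum
    (∀ σ : ℝ, 0 ≤ σ →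
      ∀ a : (Fin n → ℕ) → Monogenic.Cl n,
        Monogenic.coeffLimsup p' ρ a ≤ ENNReal.ofReal ((n : ℝ) ^ ρ * σ) →
          (∀ x, Summable fun m => Monogenic.fueterPoly m x * a m) ∧
          ∀ f : EuclideanSpace ℝ (Fin (n + 1)) → Monogenic.Cl n,
            Monogenic.HasFueterExpansion f a →
              f ∈ Monogenic.ASpaceInter n p ((n : ℝ) ^ ρ * σ)) ∧
    -- characterization of the union space
    (∀ (f : EuclideanSpace ℝ (Fin (n + 1)) → Monogenic.Cl n) (a : (Fin n → ℕ) → Monogenic.Cl n),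
      Monogenic.IsMonogenic f → Monogenic.HasFueterExpansion f a →
        (f ∈ Monogenic.ASpaceUnion n p ↔ Monogenic.coeffLimsup p' ρ a < ⊤)) := by
  refine ⟨fun σ hσ f a hfa hf =>
    Monogenic.coeffLimsup_le_of_mem_ASpaceInter hp' hρ hn hσ hfa hf,
    fun σ hσ a ha => ⟨Monogenic.summable_fueterPoly_mul hp' hρ (by positivity) ha, fun f hfa =>
      Monogenic.mem_ASpaceInter_of_coeffLimsup_le hp' hρ (by positivity) ha hfa⟩,
    fun f a _ hfa => ⟨fun hf => ?_, fun hlt => ?_⟩⟩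
  · obtain ⟨σ, hσ, hf⟩ := Set.mem_iUnion₂.1 hf
    exact (Monogenic.coeffLimsup_le_of_mem_ASpace hp' hρ hn hσ hfa hf).trans_lt
      ENNReal.ofReal_lt_top
  -- The type is taken to be the finite limsup itself; adding `1` makes it positive, as the union
  -- requires.
  · have hf := Monogenic.mem_ASpaceInter_of_coeffLimsup_le hp' hρ ENNReal.toReal_nonneg
      (ENNReal.ofReal_toReal hlt.ne).ge hfa
    have hpos : 0 < (Monogenic.coeffLimsup p' ρ a).toReal + 1 :=
      add_pos_of_nonneg_of_pos ENNReal.toReal_nonneg one_pos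
    exact Set.mem_iUnion₂.2 ⟨_, hpos, Set.mem_iInter₂.1 hf 1 one_pos⟩
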